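/- **Setting.** Let $R=\mathbb C[t,t^{-1},u\mid u^2=t^2+4t]$, let $e,f,h$ be the standard basis of $\mathfrak{sl}(2,\mathbb C)$ and $(x,y)=\operatorname{tr}(xy)$. The three point algebra is $\hat{\mathfrak g}=(\mathfrak{sl}(2,\mathbb C)\otimes R)\oplus\Omega^1_R/dR$ with $$[x\otimes a,\,y\otimes b]=[x,y]\otimes ab+(x,y)\,\overline{a\,db},\qquad \Omega^1_R/dR\ \text{ central}.$$ Put $\omega_0=\overline{t^{-1}dt}$ and $\omega_1=\overline{t^{-1}u\,dt}$ (these form a basis of $\Omega_R^1/dR$, so $\hat{\mathfrak g}=(\mathfrak{sl}(2,\mathbb C)\otimes R)\oplus\mathbb C\omega_0\oplus\mathbb C\omega_1$). For $x\in\{e,f,h\}$ put $x(z)=\sum_{n\in\mathbb Z}(x\otimes t^n)z^{-n-1}$ and $x^1(z)=\sum_{n\in\mathbb Z}(x\otimes ut^n)z^{-n-1}$. Fix $r\in\{0,1\}$ and $\lambda,\mu,\nu,\varkappa,\kappa_0\in\mathbb C$, and put $\chi_0=\kappa_0+4\delta_{r,0}$. Let $\mathbb C[\mathbf x]=\mathbb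 C[x_n,x_n^1\mid n\in\mathbb Z]$, $\mathbb C[\mathbf y]=\mathbb C[y_n,y^1_n\mid n<0]$, and $\mathcal V=\mathbb C\mathbf v_0\oplus\mathbb C\mathbf v_1$. *The $\beta$–$\gamma$ system.* On $\mathbb C[\mathbf x]$ let $a_n=\partial/\partial x_n$ if $n\ge0$ and $r=0$, and $a_n=x_n$ otherwise; let $a^*_n=x_{-n}$ if $n\le 0$ and $r=0$, and $a_n^*=-\partial/\partial x_{-n}$ otherwise. Define $a^1_n,a^{1*}_n$ in the same way with the variables $x^1_n$. Put $$\alpha(z)=\sum_{n} a_nz^{-n-1},\quad \alpha^*(z)=\sum_n a^*_nz^{-n},\quad \alpha^1(z)=\sum_n a^1_nz^{-n-1},\quad \alpha^{1*}(z)=\sum_n a^{1*}_nz^{-n}.$$ *The 3-point Heisenberg fields.* Let $B$ be the operator on $\mathcal V$ with $B\mathbf v_0=\mu\mathbf v_0+\nu\mathbf v_1$ and $B\mathbf v_1=\varkappa\mathbf v_0+\mu\mathbf v_1$. On $\mathbb C[\mathbf y]\otimes\mathcal V$ let $$b_n=y_n\ (n<0),\qquad b_0=\lambda,\qquad b_n=-2n\kappa_0\,\partial_{y_{-n}}\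 (n>0),$$ $$b^1_n=y^1_n\ (n<0),\qquad b^1_0=-2\kappa_0\,\partial_{y^1_{-2}}-4\kappa_0\,\partial_{y^1_{-1}}+B,$$ $$b^1_n=-2(n+1)\kappa_0\,\partial_{y^1_{-n-2}}-4(2n+1)\kappa_0\,\partial_{y^1_{-n-1}}\ (n>0).$$ Put $\beta(z)=\sum_n b_nz^{-n-1}$ and $\beta^1(z)=\sum_nb^1_nz^{-n-1}$. (This is the representation of the 3-point Heisenberg algebra $[b_m,b_n]=(n-m)\delta_{m+n,0}\mathbf 1_0$, $[b^1_m,b^1_n]=(n-m)(\delta_{m+n,-2}+4\delta_{m+n,-1})\mathbf 1_0$, $[b^1_m,b_n]=(n-m)\delta_{m+n,0}\mathbf 1_1$ with $\mathbf 1_0=\kappa_0$, $\mathbf 1_1=0$ induced from $\mathcal V$.) *Normal ordering.* For a formal distribution with a splitting $c(z)=c(z)_++c(z)_-$ put $:c(z)d(z):\,=c(z)_+d(z)+d(z)c(z)_-$ and $:c\,d\,g:\,=\,:c\,(:d\,g:):$. If $r=0$, use the usual splitting: for $c(z)=\sum_m c_mz^{-m-1}$, $c(z)_-=\sum_{m\ge0}c_mz^{-m-1}$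 and $c(z)_+=\sum_{m<0}c_mz^{-m-1}$. If $r=1$, use the natural one: $\alpha_+=\alpha$, $\alpha_-=0$, $\alpha^*_+=0$, $\alpha^*_-=\alpha^*$, and likewise for $\alpha^1,\alpha^{1*}$. Such a product is defined if each of its coefficients is a sum of operators only finitely many of which are nonzero on any given vector. **Theorem.** All the products $:\alpha^i\alpha^{j*}:$, $:\alpha^{j*}\alpha^{k*}:$, $:\alpha^i\alpha^{j*}\alpha^{k*}:$, $\beta\alpha^{j*}$ and $\beta^1\alpha^{j*}$ (for $i,j,k\in\{0,1\}$, where $\alpha^0=\alpha$ and $\alpha^{0*}=\alpha^*$) are defined, and there is exactly one representation $\tau$ of the Lie algebra $\hat{\mathfrak g}$ on $\mathbb C[\mathbf x]\otimes\mathbb C[\mathbf y]\otimes\mathcal V$ such that $$\begin{aligned} \tau(\omega_1)&=0,\qquad \tau(\omega_0)=\chi_0=\kappa_0+4\delta_{r,0},\\ \tau(f(z))&=-\alpha,\qquad \tau(f^1(z))=-\alpha^1,\\ \tau(h(z))&=2\left(:\alpha\alpha^*:+:\alpha^1\alpha^{1*}:\right)+\beta,\\ \tau(h^1(z))&=2\left(:\alpha^1\alpha^*:+(z^2+4z):\alpha\alpha^{1*}:\right)+\beta^1,\\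 \tau(e(z))&=\,:\alpha(\alpha^*)^2:+(z^2+4z):\alpha(\alpha^{1*})^2:+2:\alpha^1\alpha^*\alpha^{1*}:+\beta\alpha^*+\beta^1\alpha^{1*}+\chi_0\partial_z\alpha^*,\\ \tau(e^1(z))&=\,:\alpha^1(\alpha^*)^2:+(z^2+4z)\left(:\alpha^1(\alpha^{1*})^2:+2:\alpha\alpha^*\alpha^{1*}:\right)+\beta^1\alpha^*+(z^2+4z)\beta\alpha^{1*}\\ &\quad+\chi_0\left((z^2+4z)\partial_z\alpha^{1*}+(z+2)\alpha^{1*}\right). \end{aligned}$$ -/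

import Mathlib

open scoped TensorProduct
open scoped LaurentPolynomial

noncomputable section

namespace ThreePoint

/-! ### The universal central extension of `sl(2, ℂ) ⊗ A` -/

/-- The Lie algebra `sl(2, ℂ)` of traceless `2 × 2` complex matrices. -/
abbrev Sl2 : Type := LieAlgebra.SpecialLinear.sl (Fin 2) ℂ

/-- The standard basis vector `e`. -/
def slE : Sl2 := ⟨!![0, 1; 0, 0], by simp [LieAlgebra.SpecialLinear.sl, Matrix.trace_fin_two]⟩

/-- The standard basis vector `f`. -/
def slF : Sl2 := ⟨!![0, 0; 1, 0], by simp [LieAlgebra.SpecialLinear.sl, Matrix.trace_fin_two]⟩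

/-- The standard basis vector `h`. -/
def slH : Sl2 := ⟨!![1, 0; 0, -1], by simp [LieAlgebra.SpecialLinear.sl, Matrix.trace_fin_two]⟩

/-- The invariant form `(x, y) = tr (x y)` on `sl(2, ℂ)`, i.e. the Killing form normalized by
`(e, f) = 1`, `(h, h) = 2`. -/
def form : Sl2 →ₗ[ℂ] Sl2 →ₗ[ℂ] ℂ :=
  LinearMap.mk₂ ℂ (fun x y => Matrix.trace (x.1 * y.1))
    (fun x y z => by simp [add_mul]) (fun c x y => by simp)
    (fun x y z => by simp [mul_add]) (fun c x y => by simp)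

section Extension

variable (A : Type) [CommRing A] [Algebra ℂ A]

/-- Kähler differentials modulo exact differentials, `Ω¹_A / dA`. -/
abbrev DiffModExact : Type :=
  Ω[A⁄ℂ] ⧸ LinearMap.range ((KaehlerDifferential.D ℂ A : Derivation ℂ A (Ω[A⁄ℂ])) : A →ₗ[ℂ] Ω[A⁄ℂ])

variable {A} in
/-- The class of a differential modulo exact differentials. -/
def diffClass : Ω[A⁄ℂ] →ₗ[ℂ] DiffModExact A :=
  Submodule.mkQ _

/-- The pairing `(f, g) ↦` class of `f dg`. -/
def diffPairing : A →ₗ[ℂ] A →ₗ[ℂ] DiffModExact A :=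
  LinearMap.mk₂ ℂ (fun f g => diffClass (f • KaehlerDifferential.D ℂ A g))
    (fun f f' g => by simp [add_smul]) (fun c f g => by simp)
    (fun f g g' => by simp [smul_add])
    (fun c f g => by rw [Derivation.map_smul, smul_comm, map_smul])

/-- The bilinear map with `(f ⊗ x, g ⊗ y) ↦ (x, y) • (class of f dg)`. -/
def cocycle : (A ⊗[ℂ] Sl2) →ₗ[ℂ] (A ⊗[ℂ] Sl2) →ₗ[ℂ] DiffModExact A :=
  (TensorProduct.map₂ (diffPairing A) form).compr₂ (TensorProduct.rid ℂ (DiffModExact A)).toLinearMap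

lemma cocycle_tmul (f g : A) (x y : Sl2) :
    cocycle A (f ⊗ₜ x) (g ⊗ₜ y) =
      form x y • diffClass (f • KaehlerDifferential.D ℂ A g) := by
  simp [cocycle, diffPairing]

/-- The vector space `(sl(2, ℂ) ⊗ A) ⊕ Ω¹_A / dA`. -/
def CentralExt : Type := (A ⊗[ℂ] Sl2) × DiffModExact A

instance : AddCommGroup (CentralExt A) :=
  inferInstanceAs (AddCommGroup ((A ⊗[ℂ] Sl2) × DiffModExact A))

instance : Module ℂ (CentralExt A) :=
  inferInstanceAs (Module ℂ ((A ⊗[ℂ] Sl2) × DiffModExact A))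

/-- `[x ⊗ f, y ⊗ g] = [x, y] ⊗ f g + (x, y) • (class of f dg)`, with `Ω¹_A / dA` central. -/
instance : Bracket (CentralExt A) (CentralExt A) where
  bracket a b := (⁅a.1, b.1⁆, cocycle A a.1 b.1)

lemma form_comm (x y : Sl2) : form x y = form y x := by
  simp [form, Matrix.trace_mul_comm x.1 y.1]

lemma form_inv (x y z : Sl2) : form x ⁅y, z⁆ = form ⁅x, y⁆ z := by
  simp only [form, LinearMap.mk₂_apply, LieSubalgebra.coe_bracket, Ring.lie_def, mul_sub, sub_mul,
    Matrix.trace_sub]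
  rw [Matrix.trace_mul_cycle' x.1 z.1 y.1, ← mul_assoc, ← mul_assoc]

lemma diffClass_D (f : A) : diffClass (KaehlerDifferential.D ℂ A f) = 0 := by
  rw [diffClass, Submodule.mkQ_apply, Submodule.Quotient.mk_eq_zero]
  exact ⟨f, rfl⟩

lemma cocycle_skew (a b : A ⊗[ℂ] Sl2) : cocycle A a b = - cocycle A b a := by
  induction a using TensorProduct.induction_on with
  | zero => simp
  | add a a' h h' => simp only [map_add, LinearMap.add_apply, h, h', neg_add]
  | tmul f x =>
    induction b using TensorProduct.induction_on with
    | zero => simp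
    | add b b' h h' => simp only [map_add, LinearMap.add_apply, h, h', neg_add]
    | tmul g y =>
      rw [cocycle_tmul, cocycle_tmul, form_comm y x, ← smul_neg]
      congr 1
      rw [eq_neg_iff_add_eq_zero, ← map_add, ← Derivation.leibniz, diffClass_D]

lemma cocycle_self (a : A ⊗[ℂ] Sl2) : cocycle A a a = 0 := by
  have h := cocycle_skew A a a
  rw [eq_neg_iff_add_eq_zero, ← two_smul ℂ] at h
  exact (smul_eq_zero.mp h).resolve_left two_ne_zero

lemma cocycle_jacobi (a b c : A ⊗[ℂ] Sl2) :
    cocycle A a ⁅b, c⁆ = cocycle A ⁅a, b⁆ c + cocycle A b ⁅a, c⁆ := by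
  have hadd (p q s : A ⊗[ℂ] Sl2) : ⁅p + q, s⁆ = ⁅p, s⁆ + ⁅q, s⁆ :=
    add_lie (L := A ⊗[ℂ] Sl2) (M := A ⊗[ℂ] Sl2) p q s
  have hadd' (p q s : A ⊗[ℂ] Sl2) : ⁅p, q + s⁆ = ⁅p, q⁆ + ⁅p, s⁆ :=
    lie_add (L := A ⊗[ℂ] Sl2) (M := A ⊗[ℂ] Sl2) p q s
  have hz (p : A ⊗[ℂ] Sl2) : ⁅(0 : A ⊗[ℂ] Sl2), p⁆ = 0 :=
    zero_lie (L := A ⊗[ℂ] Sl2) (M := A ⊗[ℂ] Sl2) p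
  have hz' (p : A ⊗[ℂ] Sl2) : ⁅p, (0 : A ⊗[ℂ] Sl2)⁆ = 0 :=
    lie_zero (L := A ⊗[ℂ] Sl2) (M := A ⊗[ℂ] Sl2) p
  induction a using TensorProduct.induction_on with
  | zero => simp [hz]
  | add a a' h h' => simp only [map_add, LinearMap.add_apply, hadd, h, h']; abel
  | tmul f x =>
    induction b using TensorProduct.induction_on with
    | zero => simp [hz, hz']
    | add b b' h h' => simp only [map_add, LinearMap.add_apply, hadd, hadd', h, h']; abel
    | tmul g y =>
      induction c using TensorProduct.induction_on with
      | zero => simp [hz']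
      | add c c' h h' => simp only [map_add, hadd', h, h']; abel
      | tmul k z =>
        simp only [LieAlgebra.ExtendScalars.bracket_tmul, cocycle_tmul]
        have h1 : form y ⁅x, z⁆ = - form ⁅x, y⁆ z := by
          rw [form_inv, ← lie_skew, map_neg, LinearMap.neg_apply]
        rw [form_inv x y z, h1, neg_smul, ← smul_neg, ← smul_add]
        congr 1
        rw [← sub_eq_add_neg, ← map_sub, ← sub_eq_zero, ← map_sub,
          ← diffClass_D A (f * (g * k))]
        congr 1
        simp only [Derivation.leibniz, smul_add, smul_smul]
        rw [mul_comm g f]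
        abel

instance : LieRing (CentralExt A) where
  add_lie a b c := Prod.ext (add_lie (L := A ⊗[ℂ] Sl2) (M := A ⊗[ℂ] Sl2) a.1 b.1 c.1) (by
    change cocycle A (a.1 + b.1) c.1 = cocycle A a.1 c.1 + cocycle A b.1 c.1
    simp)
  lie_add a b c := Prod.ext (lie_add (L := A ⊗[ℂ] Sl2) (M := A ⊗[ℂ] Sl2) a.1 b.1 c.1)
    (map_add (cocycle A a.1) b.1 c.1)
  lie_self a := Prod.ext (lie_self (L := A ⊗[ℂ] Sl2) a.1) (cocycle_self A a.1)
  leibniz_lie a b c := Prod.ext (LieRing.leibniz_lie (L := A ⊗[ℂ] Sl2) a.1 b.1 c.1)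
    (cocycle_jacobi A a.1 b.1 c.1)

instance : LieAlgebra ℂ (CentralExt A) where
  lie_smul t a b := Prod.ext (LieAlgebra.lie_smul (L := A ⊗[ℂ] Sl2) t a.1 b.1)
    (map_smul (cocycle A a.1) t b.1)

end Extension

/-! ### The three point ring and the three point algebra -/

/-- The three point ring `R = ℂ[t, t⁻¹, u | u² = t² + 4t]`. -/
abbrev Ring3 : Type :=
  AdjoinRoot (Polynomial.X ^ 2 -
    Polynomial.C (LaurentPolynomial.T 2 + 4 * LaurentPolynomial.T 1 : ℂ[T;T⁻¹]))

/-- The element `tⁿ` of `R`. -/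
def tPow (n : ℤ) : Ring3 := AdjoinRoot.of _ (LaurentPolynomial.T n)

/-- The element `u` of `R`. -/
def uElt : Ring3 := AdjoinRoot.root _

/-- The three point algebra `(sl(2, ℂ) ⊗ R) ⊕ Ω¹_R / dR`. -/
abbrev Alg3 : Type := CentralExt Ring3

/-- `x_n = x ⊗ tⁿ`. -/
def mode (x : Sl2) (n : ℤ) : Alg3 := (tPow n ⊗ₜ x, 0)

/-- `x¹_n = x ⊗ u tⁿ`. -/
def mode1 (x : Sl2) (n : ℤ) : Alg3 := ((uElt * tPow n) ⊗ₜ x, 0)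

/-- `ω₀ =` class of `t⁻¹ dt`. -/
def omega0 : Alg3 := (0, diffClass (tPow (-1) • KaehlerDifferential.D ℂ Ring3 (tPow 1)))

/-- `ω₁ =` class of `t⁻¹ u dt`. -/
def omega1 : Alg3 := (0, diffClass ((tPow (-1) * uElt) • KaehlerDifferential.D ℂ Ring3 (tPow 1)))

/-! ### Formal distributions and normal ordered products -/

section Distributions

variable {M : Type} [AddCommGroup M] [Module ℂ M]

/-- A formal distribution `a(z) = ∑ aₙ z^(-n-1)` with coefficients in `End M`, as the family of the
`aₙ`: the value at `n` is the coefficient of `z^(-n-1)`. -/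
abbrev Dist (M : Type) [AddCommGroup M] [Module ℂ M] : Type := ℤ → Module.End ℂ M

/-- A family of operators is locally finite if only finitely many of its members are nonzero on
any given vector. -/
def LocallyFinite (S : ℤ → Module.End ℂ M) : Prop :=
  ∀ v, (Function.support fun m => S m v).Finite

open Classical in
/-- The (pointwise finite) sum of a locally finite family of operators. -/
def locSum (S : ℤ → Module.End ℂ M) : Module.End ℂ M :=
  if h : LocallyFinite S then
    { toFun := fun v => ∑ᶠ m, S m v
      map_add' := fun v w => by
        simp only [map_add]
        exact finsum_add_distrib (h v) (h w)
      map_smul' := fun c v => by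
        simp only [map_smul, RingHom.id_apply]
        exact (smul_finsum' c (h v)).symm }
  else 0

/-- A formal distribution with a splitting `a(z) = a(z)₊ + a(z)₋`. -/
structure SplitDist (M : Type) [AddCommGroup M] [Module ℂ M] where
  /-- the part `a(z)₊` -/
  plus : Dist M
  /-- the part `a(z)₋` -/
  minus : Dist M

/-- The usual splitting: `a(z)₋ = ∑_{m ≥ 0} aₘ z^(-m-1)`, `a(z)₊ = ∑_{m < 0} aₘ z^(-m-1)`. -/
def usualSplit (a : Dist M) : SplitDist M where
  plus := fun m => if m < 0 then a m else 0
  minus := fun m => if 0 ≤ m then a m else 0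

/-- The summands of the coefficient of `z^(-k-1)` in `a(z)₊ b(z) + b(z) a(z)₋`. -/
def normTerm (a : SplitDist M) (b : Dist M) (k m : ℤ) : Module.End ℂ M :=
  a.plus m * b (k - 1 - m) + b (k - 1 - m) * a.minus m

/-- The normal ordered product `:a(z)b(z): = a(z)₊ b(z) + b(z) a(z)₋`. -/
def normProd (a : SplitDist M) (b : Dist M) : Dist M := fun k => locSum (normTerm a b k)

/-- The product `:a(z)b(z):` is defined. -/
def NormDefined (a : SplitDist M) (b : Dist M) : Prop := ∀ k, LocallyFinite (normTerm a b k)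

/-- The summands of the coefficient of `z^(-k-1)` in `a(z) b(z)`. -/
def plainTerm (a b : Dist M) (k m : ℤ) : Module.End ℂ M := a m * b (k - 1 - m)

/-- The product `a(z)b(z)` (without normal ordering). -/
def plainProd (a b : Dist M) : Dist M := fun k => locSum (plainTerm a b k)

/-- The product `a(z)b(z)` is defined. -/
def PlainDefined (a b : Dist M) : Prop := ∀ k, LocallyFinite (plainTerm a b k)

/-- `z a(z)`. -/
def zMul (a : Dist M) : Dist M := fun k => a (k + 1)

/-- `P(z) a(z)` with `P(z) = z² + 4z`. -/
def pMul (a : Dist M) : Dist M := zMul (zMul a) + (4 : ℂ) • zMul a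

/-- `∂_z a(z)`. -/
def dz (a : Dist M) : Dist M := fun k => (-k : ℂ) • a (k - 1)

end Distributions

/-! ### The space `ℂ[x] ⊗ ℂ[y] ⊗ V` -/

/-- `ℂ[x]`: the variable `(0, n)` is `x_n` and `(1, n)` is `x¹_n`, `n ∈ ℤ`. -/
abbrev PolyX : Type := MvPolynomial (Fin 2 × ℤ) ℂ

/-- `ℂ[y]`: the variable `(0, n)` is `y_n` and `(1, n)` is `y¹_n`, `n < 0`. -/
abbrev PolyY : Type := MvPolynomial (Fin 2 × {n : ℤ // n < 0}) ℂ

/-- The space `V = ℂ v₀ ⊕ ℂ v₁`. -/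
abbrev SpaceV : Type := Fin 2 → ℂ

/-- `ℂ[x] ⊗ ℂ[y] ⊗ V`. -/
abbrev Fock : Type := PolyX ⊗[ℂ] (PolyY ⊗[ℂ] SpaceV)

/-- `gl(ℂ[x] ⊗ ℂ[y] ⊗ V)`: endomorphisms with the commutator bracket. -/
instance : LieRing (Module.End ℂ Fock) := LieRing.ofAssociativeRing

/-- An operator on `ℂ[x]`, acting on the first tensor factor. -/
def onX (S : Module.End ℂ PolyX) : Module.End ℂ Fock := LinearMap.rTensor _ S

/-- An operator on `ℂ[y]`, acting on the second tensor factor. -/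
def onY (S : Module.End ℂ PolyY) : Module.End ℂ Fock :=
  LinearMap.lTensor _ (LinearMap.rTensor _ S)

/-- An operator on `V`, acting on the third tensor factor. -/
def onV (S : Module.End ℂ SpaceV) : Module.End ℂ Fock :=
  LinearMap.lTensor _ (LinearMap.lTensor _ S)

/-- Multiplication by a variable of `ℂ[x]`. -/
def xMul (i : Fin 2) (n : ℤ) : Module.End ℂ Fock :=
  onX (LinearMap.mulLeft ℂ (MvPolynomial.X (i, n)))

/-- Partial derivative with respect to a variable of `ℂ[x]`. -/
def xDer (i : Fin 2) (n : ℤ) : Module.End ℂ Fock :=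
  onX (MvPolynomial.pderiv (i, n) : Derivation ℂ PolyX PolyX).toLinearMap

/-- Multiplication by a variable of `ℂ[y]`. -/
def yMul (i : Fin 2) (n : ℤ) (hn : n < 0) : Module.End ℂ Fock :=
  onY (LinearMap.mulLeft ℂ (MvPolynomial.X (i, ⟨n, hn⟩)))

/-- Partial derivative with respect to a variable of `ℂ[y]`. -/
def yDer (i : Fin 2) (n : ℤ) (hn : n < 0) : Module.End ℂ Fock :=
  onY (MvPolynomial.pderiv (i, ⟨n, hn⟩) : Derivation ℂ PolyY PolyY).toLinearMap

/-! ### The `β-γ` system -/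

/-- `ρ_r(a_n)` for `i = 0`, `ρ_r(a¹_n)` for `i = 1`. -/
def oscA (r i : Fin 2) (n : ℤ) : Module.End ℂ Fock :=
  if 0 ≤ n ∧ r = 0 then xDer i n else xMul i n

/-- `ρ_r(a*_n)` for `i = 0`, `ρ_r(a¹*_n)` for `i = 1`. -/
def oscAStar (r i : Fin 2) (n : ℤ) : Module.End ℂ Fock :=
  if n ≤ 0 ∧ r = 0 then xMul i (-n) else -xDer i (-n)

/-- `α(z) = ∑ a_n z^(-n-1)` for `i = 0`, `α¹(z)` for `i = 1`. -/
def alpha (r i : Fin 2) : Dist Fock := fun n => oscA r i n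

/-- `α*(z) = ∑ a*_n z^(-n)` for `i = 0`, `α¹*(z)` for `i = 1`. The coefficient of `z^(-n-1)` is
`a*_(n+1)`. -/
def alphaStar (r i : Fin 2) : Dist Fock := fun n => oscAStar r i (n + 1)

/-- The splitting of `α`, `α¹`: usual for `r = 0`, and `α₊ = α`, `α₋ = 0` (natural) for `r = 1`. -/
def alphaSplit (r i : Fin 2) : SplitDist Fock :=
  if r = 0 then usualSplit (alpha r i) else ⟨alpha r i, 0⟩

/-- The splitting of `α*`, `α¹*`: usual for `r = 0`, and `α*₊ = 0`, `α*₋ = α*` (natural) for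
`r = 1`. -/
def alphaStarSplit (r i : Fin 2) : SplitDist Fock :=
  if r = 0 then usualSplit (alphaStar r i) else ⟨0, alphaStar r i⟩

/-! ### The 3-point Heisenberg fields -/

/-- The action `B` of `b¹_0` on `V`: `v₀ ↦ μ v₀ + ν v₁`, `v₁ ↦ ϰ v₀ + μ v₁`. -/
def opB (mu nu kap : ℂ) : Module.End ℂ SpaceV := Matrix.toLin' !![mu, kap; nu, mu]

/-- The action of `b_n`, with `b_0 = lam`, on the module induced from `V`. -/
def heis (lam κ₀ χ₁ : ℂ) (n : ℤ) : Module.End ℂ Fock :=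
  if h : n < 0 then yMul 0 n h
  else if h0 : n = 0 then lam • 1
  else (-2 * n * κ₀ : ℂ) • yDer 0 (-n) (by omega) + (-2 * n * χ₁ : ℂ) • yDer 1 (-n) (by omega)

/-- The action of `b¹_n` on the module induced from `V`. -/
def heis1 (mu nu kap κ₀ χ₁ : ℂ) (n : ℤ) : Module.End ℂ Fock :=
  if h : n < 0 then yMul 1 n h
  else if h0 : n = 0 then
    (-2 * κ₀) • yDer 1 (-2) (by omega) + (-4 * κ₀) • yDer 1 (-1) (by omega) + onV (opB mu nu kap)
  else
    (-2 * n * χ₁ : ℂ) • yDer 0 (-n) (by omega)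
      + (-2 * (n + 1) * κ₀ : ℂ) • yDer 1 (-n - 2) (by omega)
      + (-4 * (2 * n + 1) * κ₀ : ℂ) • yDer 1 (-n - 1) (by omega)

/-! ### The fields of the realization -/

/-- `:α^i (α^j)*:`, with `α⁰ = α`. -/
def quad (r i j : Fin 2) : Dist Fock := normProd (alphaSplit r i) (alphaStar r j)

/-- `:(α^j)* (α^k)*:`. -/
def starQuad (r j k : Fin 2) : Dist Fock := normProd (alphaStarSplit r j) (alphaStar r k)

/-- `:α^i (α^j)* (α^k)*: = :α^i (:(α^j)* (α^k)*:):`. -/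
def cubic (r i j k : Fin 2) : Dist Fock := normProd (alphaSplit r i) (starQuad r j k)

/-- `τ(f^i(z)) = -α^i`. -/
def tauF (r i : Fin 2) : Dist Fock := -alpha r i

/-- `τ(h(z)) = 2(:αα*: + :α¹α¹*:) + β`. -/
def tauH (r : Fin 2) (β : Dist Fock) : Dist Fock :=
  (2 : ℂ) • (quad r 0 0 + quad r 1 1) + β

/-- `τ(h¹(z)) = 2(:α¹α*: + (z²+4z) :αα¹*:) + β¹`. -/
def tauH1 (r : Fin 2) (β₁ : Dist Fock) : Dist Fock :=
  (2 : ℂ) • (quad r 1 0 + pMul (quad r 0 1)) + β₁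

/-- `τ(e(z)) = :α(α*)²: + (z²+4z) :α(α¹*)²: + 2 :α¹α*α¹*: + βα* + β¹α¹* + χ₀ ∂α*`. -/
def tauE (r : Fin 2) (χ₀ : ℂ) (β β₁ : Dist Fock) : Dist Fock :=
  cubic r 0 0 0 + pMul (cubic r 0 1 1) + (2 : ℂ) • cubic r 1 0 1
    + plainProd β (alphaStar r 0) + plainProd β₁ (alphaStar r 1) + χ₀ • dz (alphaStar r 0)

/-- `τ(e¹(z)) = :α¹(α*)²: + (z²+4z)(:α¹(α¹*)²: + 2 :αα*α¹*:) + β¹α* + (z²+4z) βα¹*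
+ χ₀((z²+4z) ∂α¹* + (z+2) α¹*)`. -/
def tauE1 (r : Fin 2) (χ₀ : ℂ) (β β₁ : Dist Fock) : Dist Fock :=
  cubic r 1 0 0 + pMul (cubic r 1 1 1 + (2 : ℂ) • cubic r 0 0 1)
    + plainProd β₁ (alphaStar r 0) + pMul (plainProd β (alphaStar r 1))
    + χ₀ • (pMul (dz (alphaStar r 1)) + (zMul (alphaStar r 1) + (2 : ℂ) • alphaStar r 1))

end ThreePoint

end

/-! Let F, H, E denote the linear maps from R to operators assembled from the modes of the fields
for f, h, e. Brackets with F are computed directly. The modes of α and α¹ commute with one another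
and contract with α*, α¹* to scalars, so bracketing with F strips one starred factor off a normally
ordered product and leaves no reordering terms. This carries H to F and E to H, and the terms with
coefficient χ₀ in E produce the cocycle (`opF_opH`, `opF_opE`).

The brackets [H,H], [E,H], [E,E] are never expanded. Grade the operators by a charge that α lowers
by one and α* raises by one. By `eq_zero_of_commute_oscA`, an operator that commutes with all modes
of α, α¹ and raises the charge by d is zero if d > 0; if d = 0, it is zero as soon as its vacuum
expectation is. For each of the three relations, the difference of the two sides commutes with F by
the Jacobi identity and the relations already known. For [E,H] and [E,E] the charge is 1 and 2, so
nothing is left to check. Only [H,H] has charge 0 and requires a vacuum expectation: the Heisenberg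
fields contribute κ₀, and the double contractions of the quadratic terms contribute a further 4 for
the usual ordering and nothing for the natural one (`vacExp_adR_quad_quad`). This is the source of
χ₀ = κ₀ + 4δ.

The central terms are evaluated by contracting a differential with the vector field u d/dt and
reading off the coefficient of u t⁻¹; this kills exact differentials, sends ω₀ to 1 and ω₁ to 0
(`residue`). Uniqueness holds because the modes span sl(2) ⊗ R, and the brackets of e ⊗ a with f ⊗ b
then recover every class of a db (`algHom_ext`). -/

noncomputable section

namespace ThreePoint

/-! ### Locally finite sums and commutators -/

section Commutators

variable {M : Type} [AddCommGroup M] [Module ℂ M]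

/-- The right adjoint action `T ↦ T A - A T`. -/
def adR (A : Module.End ℂ M) : Module.End ℂ M →ₗ[ℂ] Module.End ℂ M :=
  LinearMap.mulRight ℂ A - LinearMap.mulLeft ℂ A

lemma adR_apply (A T : Module.End ℂ M) : adR A T = T * A - A * T := rfl

lemma adR_mul (A S T : Module.End ℂ M) : adR A (S * T) = S * adR A T + adR A S * T := by
  simp only [adR_apply]; noncomm_ring

lemma adR_swap (A T : Module.End ℂ M) : adR A T = -adR T A := by
  simp only [adR_apply]; noncomm_ring

lemma adR_one (A : Module.End ℂ M) : adR A 1 = 0 := by simp [adR_apply]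

lemma adR_jacobi (A S T : Module.End ℂ M) :
    adR A (adR T S) = adR (adR A T) S + adR T (adR A S) := by
  simp only [adR_apply]; noncomm_ring

lemma commute_of_adR_eq_zero {A T : Module.End ℂ M} (h : adR A T = 0) : T * A = A * T :=
  sub_eq_zero.mp h

lemma locSum_apply {S : ℤ → Module.End ℂ M} (h : LocallyFinite S) (v : M) :
    locSum S v = ∑ᶠ m, S m v := by
  rw [locSum, dif_pos h]; rfl

lemma LocallyFinite.mono {S S' : ℤ → Module.End ℂ M} (h : LocallyFinite S)
    (hS : ∀ m v, S m v = 0 → S' m v = 0) : LocallyFinite S' := fun v =>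
  (h v).subset fun m hm h0 => hm (hS m v h0)

lemma LocallyFinite.add {S S' : ℤ → Module.End ℂ M} (h : LocallyFinite S)
    (h' : LocallyFinite S') : LocallyFinite (fun m => S m + S' m) := fun v =>
  ((h v).union (h' v)).subset fun m hm => by
    by_contra hc
    simp only [Set.mem_union, Function.mem_support, not_or, not_not] at hc
    exact hm (by simp [hc.1, hc.2])

lemma LocallyFinite.smul {S : ℤ → Module.End ℂ M} (h : LocallyFinite S) (c : ℂ) :
    LocallyFinite (fun m => c • S m) :=
  h.mono fun m v hv => by simp [hv]

lemma LocallyFinite.adR {S : ℤ → Module.End ℂ M} (h : LocallyFinite S) (A : Module.End ℂ M) :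
    LocallyFinite (fun m => adR A (S m)) := fun v =>
  ((h (A v)).union (h v)).subset fun m hm => by
    by_contra hc
    simp only [Set.mem_union, Function.mem_support, not_or, not_not] at hc
    exact hm (by simp [adR_apply, hc.1, hc.2])

lemma locSum_add {S S' : ℤ → Module.End ℂ M} (h : LocallyFinite S) (h' : LocallyFinite S') :
    locSum (fun m => S m + S' m) = locSum S + locSum S' := by
  ext v
  rw [LinearMap.add_apply, locSum_apply h, locSum_apply h', locSum_apply (h.add h')]
  exact finsum_add_distrib (h v) (h' v)

lemma locSum_smul {S : ℤ → Module.End ℂ M} (h : LocallyFinite S) (c : ℂ) :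
    locSum (fun m => c • S m) = c • locSum S := by
  ext v
  rw [LinearMap.smul_apply, locSum_apply h, locSum_apply (h.smul c)]
  exact (smul_finsum' c (h v)).symm

lemma locallyFinite_of_single {S : ℤ → Module.End ℂ M} {n : ℤ} (h : ∀ m, m ≠ n → S m = 0) :
    LocallyFinite S := fun v => (Set.finite_singleton n).subset fun m hm => by
  by_contra hc
  exact hm (by simp [h m hc])

lemma locSum_eq_single {S : ℤ → Module.End ℂ M} (n : ℤ) (h : ∀ m, m ≠ n → S m = 0) :
    locSum S = S n := by
  ext v
  rw [locSum_apply (locallyFinite_of_single h), finsum_eq_single _ n]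
  intro m hm
  simp [h m hm]

lemma map_locSum {N : Type*} [AddCommGroup N] [Module ℂ N] {S : ℤ → Module.End ℂ M}
    (h : LocallyFinite S) (f : M →ₗ[ℂ] N) (v : M) : f (locSum S v) = ∑ᶠ m, f (S m v) := by
  rw [locSum_apply h]
  exact map_finsum f (h v)

/-- On a vector v only the sums at v and at A v enter, and both are finite; so the commutator may be
taken term by term. -/
lemma adR_locSum {S : ℤ → Module.End ℂ M} (h : LocallyFinite S) (A : Module.End ℂ M) :
    adR A (locSum S) = locSum fun m => adR A (S m) := by
  ext v
  rw [locSum_apply (h.adR A), adR_apply, LinearMap.sub_apply, Module.End.mul_apply,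
    Module.End.mul_apply, map_locSum h, locSum_apply h, ← finsum_sub_distrib (h _)]
  · rfl
  · exact (h v).subset fun m hm h0 => hm (by simp [h0])

/-! ### Calculus of normally ordered products -/

lemma normTerm_comp_add (a : SplitDist M) (b : Dist M) (n k m : ℤ) :
    normTerm a (fun p => b (p + n)) k m = normTerm a b (k + n) m := by
  simp only [normTerm]
  rw [show k - 1 - m + n = k + n - 1 - m by ring]

lemma normTerm_smul (a : SplitDist M) (b : Dist M) (c : ℂ) (k m : ℤ) :
    normTerm a (fun p => c • b p) k m = c • normTerm a b k m := by
  simp [normTerm]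

lemma normTerm_add (a : SplitDist M) (b b' : Dist M) (k m : ℤ) :
    normTerm a (fun p => b p + b' p) k m = normTerm a b k m + normTerm a b' k m := by
  simp only [normTerm]; noncomm_ring

lemma normProd_comp_add (a : SplitDist M) (b : Dist M) (n k : ℤ) :
    normProd a (fun p => b (p + n)) k = normProd a b (k + n) := by
  simp only [normProd]
  congr 1; ext1 m
  exact normTerm_comp_add a b n k m

lemma NormDefined.comp_add {a : SplitDist M} {b : Dist M} (h : NormDefined a b) (n : ℤ) :
    NormDefined a (fun p => b (p + n)) := fun k => by
  have := h (k + n)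
  rwa [← funext (normTerm_comp_add a b n k)] at this

lemma NormDefined.smul {a : SplitDist M} {b : Dist M} (h : NormDefined a b) (c : ℂ) :
    NormDefined a (fun p => c • b p) := fun k => by
  rw [funext (normTerm_smul a b c k)]
  exact (h k).smul c

lemma normProd_smul {a : SplitDist M} {b : Dist M} (h : NormDefined a b) (c : ℂ) (k : ℤ) :
    normProd a (fun p => c • b p) k = c • normProd a b k := by
  simp only [normProd]
  rw [← locSum_smul (h k), funext (normTerm_smul a b c k)]

lemma normProd_add {a : SplitDist M} {b b' : Dist M} (h : NormDefined a b)
    (h' : NormDefined a b') (k : ℤ) :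
    normProd a (fun p => b p + b' p) k = normProd a b k + normProd a b' k := by
  simp only [normProd]
  rw [← locSum_add (h k) (h' k), funext (normTerm_add a b b' k)]

/-- The product with a field having a single coefficient, which is scalar. -/
lemma normProd_single (a : SplitDist M) (c : ℂ) (n k : ℤ) :
    normProd a (fun p => if p = n then c • (1 : Module.End ℂ M) else 0) k =
      c • (a.plus (k - 1 - n) + a.minus (k - 1 - n)) := by
  simp only [normProd]
  rw [locSum_eq_single (k - 1 - n)]
  · simp [normTerm]
  · intro m hm
    have : k - 1 - m ≠ n := fun h => hm (by omega)
    simp [normTerm, this]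

lemma adR_normTerm {a : SplitDist M} {A : Module.End ℂ M}
    (hp : ∀ m, adR A (a.plus m) = 0) (hm : ∀ m, adR A (a.minus m) = 0) (b : Dist M) (k m : ℤ) :
    adR A (normTerm a b k m) = normTerm a (fun p => adR A (b p)) k m := by
  simp only [normTerm, map_add, adR_mul, hp, hm]
  simp

/-- Since A commutes with both halves of the first factor, the Leibniz rule leaves only the
commutator with the second one, in the same ordering. This is what makes brackets with the modes of
α free of anomalies. -/
lemma adR_normProd {a : SplitDist M} {A : Module.End ℂ M}
    (hp : ∀ m, adR A (a.plus m) = 0) (hm : ∀ m, adR A (a.minus m) = 0) {b : Dist M}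
    (h : NormDefined a b) (k : ℤ) :
    adR A (normProd a b k) = normProd a (fun p => adR A (b p)) k := by
  simp only [normProd]
  rw [adR_locSum (h k), funext (adR_normTerm hp hm b k)]

lemma adR_normProd_of_weight {a : SplitDist M} {A : Module.End ℂ M} {s t : ℂ}
    (hp : ∀ m, adR A (a.plus m) = s • a.plus m) (hm : ∀ m, adR A (a.minus m) = s • a.minus m)
    {b : Dist M} (hb : ∀ m, adR A (b m) = t • b m) (h : NormDefined a b) (k : ℤ) :
    adR A (normProd a b k) = (s + t) • normProd a b k := by
  simp only [normProd]
  rw [adR_locSum (h k), ← locSum_smul (h k)]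
  congr 1; ext1 m
  simp only [normTerm, map_add, adR_mul, hp, hm, hb, smul_mul_assoc, mul_smul_comm]
  module

lemma adR_plainProd {a b : Dist M} {A : Module.End ℂ M} (h : PlainDefined a b) (k : ℤ) :
    adR A (plainProd a b k) = locSum fun m =>
      a m * adR A (b (k - 1 - m)) + adR A (a m) * b (k - 1 - m) := by
  simp only [plainProd]
  rw [adR_locSum (h k)]
  congr 1; ext1 m
  rw [plainTerm, adR_mul]

lemma adR_plainProd_single {a b : Dist M} {A : Module.End ℂ M} (h : PlainDefined a b)
    (ha : ∀ m, adR A (a m) = 0) {c : ℂ} {n : ℤ}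
    (hb : ∀ m, adR A (b m) = if m = n then c • (1 : Module.End ℂ M) else 0) (k : ℤ) :
    adR A (plainProd a b k) = c • a (k - 1 - n) := by
  rw [adR_plainProd h, locSum_eq_single (k - 1 - n)]
  · simp [ha, hb]
  · intro m hm
    have : k - 1 - m ≠ n := fun h => hm (by omega)
    simp [ha, hb, this]

lemma adR_plainProd_of_weight {a b : Dist M} {A : Module.End ℂ M} (h : PlainDefined a b)
    (ha : ∀ m, adR A (a m) = 0) {t : ℂ} (hb : ∀ m, adR A (b m) = t • b m) (k : ℤ) :
    adR A (plainProd a b k) = t • plainProd a b k := by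
  rw [adR_plainProd h, plainProd, ← locSum_smul (h k)]
  congr 1; ext1 m
  simp [ha, hb, plainTerm]

end Commutators

/-! ### The coordinate ring -/

lemma curve_monic : (Polynomial.X ^ 2 - Polynomial.C
    (LaurentPolynomial.T 2 + 4 * LaurentPolynomial.T 1 : ℂ[T;T⁻¹])).Monic :=
  Polynomial.monic_X_pow_sub_C _ two_ne_zero

lemma curve_natDegree : (Polynomial.X ^ 2 - Polynomial.C
    (LaurentPolynomial.T 2 + 4 * LaurentPolynomial.T 1 : ℂ[T;T⁻¹])).natDegree = 2 :=
  Polynomial.natDegree_X_pow_sub_C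

/-- The `tⁿ` form a basis of the ring of Laurent polynomials. -/
def laurentBasis : Module.Basis ℤ ℂ ℂ[T;T⁻¹] := AddMonoidAlgebra.basis ℤ ℂ

lemma laurentBasis_apply (n : ℤ) : laurentBasis n = LaurentPolynomial.T n := by
  rw [laurentBasis, AddMonoidAlgebra.basis_apply]; rfl

/-- The basis `tⁿ`, `u tⁿ` of `R`. -/
def ringBasis : Module.Basis (ℤ × Fin 2) ℂ Ring3 :=
  laurentBasis.smulTower
    ((AdjoinRoot.powerBasis' curve_monic).basis.reindex (finCongr curve_natDegree))

lemma ringBasis_zero (n : ℤ) : ringBasis (n, 0) = tPow n := by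
  rw [ringBasis, Module.Basis.smulTower_apply, laurentBasis_apply, Algebra.smul_def,
    Module.Basis.reindex_apply, PowerBasis.basis_eq_pow]
  exact (congrArg _ (pow_zero _)).trans (mul_one _)

lemma ringBasis_one (n : ℤ) : ringBasis (n, 1) = uElt * tPow n := by
  rw [ringBasis, Module.Basis.smulTower_apply, laurentBasis_apply, Algebra.smul_def,
    Module.Basis.reindex_apply, PowerBasis.basis_eq_pow]
  exact (congrArg _ (pow_one _)).trans (mul_comm _ _)

/-- The linear map on `R` with prescribed values on `tⁿ` and on `u tⁿ`. -/
def ringLift {N : Type*} [AddCommGroup N] [Module ℂ N] (x y : ℤ → N) : Ring3 →ₗ[ℂ] N :=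
  ringBasis.constr ℂ fun p => if p.2 = 0 then x p.1 else y p.1

section

variable {N : Type*} [AddCommGroup N] [Module ℂ N] (x y : ℤ → N)

lemma ringLift_tPow (n : ℤ) : ringLift x y (tPow n) = x n := by
  rw [← ringBasis_zero, ringLift, Module.Basis.constr_basis]; rfl

lemma ringLift_uElt_mul (n : ℤ) : ringLift x y (uElt * tPow n) = y n := by
  rw [← ringBasis_one, ringLift, Module.Basis.constr_basis]; rfl

end

lemma ring_induction {p : Ring3 → Prop} (ht : ∀ n, p (tPow n)) (hu : ∀ n, p (uElt * tPow n))
    (hadd : ∀ a b, p a → p b → p (a + b)) (hsmul : ∀ (c : ℂ) a, p a → p (c • a)) (a : Ring3) :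
    p a := by
  have h : a ∈ Submodule.span ℂ (Set.range ringBasis) := by
    rw [ringBasis.span_eq]; trivial
  induction h using Submodule.span_induction with
  | mem x hx =>
    obtain ⟨⟨n, i⟩, rfl⟩ := hx
    fin_cases i
    · exact (ringBasis_zero n).symm ▸ ht n
    · exact (ringBasis_one n).symm ▸ hu n
  | zero => simpa using hsmul 0 _ (ht 0)
  | add x y _ _ hx hy => exact hadd x y hx hy
  | smul c x _ hx => exact hsmul c x hx

/-- A bilinear map on `R` vanishes if it does so on the basis. -/
lemma ring_bilin_eq_zero {N : Type*} [AddCommMonoid N] [Module ℂ N] (B : Ring3 →ₗ[ℂ] Ring3 →ₗ[ℂ] N)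
    (htt : ∀ m n, B (tPow m) (tPow n) = 0) (htu : ∀ m n, B (tPow m) (uElt * tPow n) = 0)
    (hut : ∀ m n, B (uElt * tPow m) (tPow n) = 0)
    (huu : ∀ m n, B (uElt * tPow m) (uElt * tPow n) = 0) (a b : Ring3) : B a b = 0 := by
  induction a using ring_induction with
  | ht m =>
    induction b using ring_induction with
    | ht n => exact htt m n
    | hu n => exact htu m n
    | hadd a b ha hb => rw [map_add, ha, hb, add_zero]
    | hsmul c a ha => rw [map_smul, ha, smul_zero]
  | hu m =>
    induction b using ring_induction with
    | ht n => exact hut m n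
    | hu n => exact huu m n
    | hadd a b ha hb => rw [map_add, ha, hb, add_zero]
    | hsmul c a ha => rw [map_smul, ha, smul_zero]
  | hadd a b ha hb => rw [B.map_add, LinearMap.add_apply, ha, hb, add_zero]
  | hsmul c a ha => rw [map_smul, LinearMap.smul_apply, ha, smul_zero]

lemma tPow_mul (m n : ℤ) : tPow m * tPow n = tPow (m + n) := by
  rw [tPow, tPow, tPow, ← map_mul, ← LaurentPolynomial.T_add]

lemma uElt_mul_self : uElt * uElt = tPow 2 + (4 : ℂ) • tPow 1 := by
  have h := AdjoinRoot.eval₂_root (Polynomial.X ^ 2 -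
    Polynomial.C (LaurentPolynomial.T 2 + 4 * LaurentPolynomial.T 1 : ℂ[T;T⁻¹]))
  rw [Polynomial.eval₂_sub, Polynomial.eval₂_pow, Polynomial.eval₂_X, Polynomial.eval₂_C,
    sub_eq_zero] at h
  rw [← sq, Algebra.smul_def, map_ofNat]
  refine h.trans ?_
  simp only [RingHom.map_add, RingHom.map_mul, map_ofNat]
  rfl

lemma tPow_mul_uElt (m n : ℤ) : tPow m * (uElt * tPow n) = uElt * tPow (m + n) := by
  rw [mul_left_comm, tPow_mul]

lemma uElt_mul_tPow (m n : ℤ) : uElt * tPow m * tPow n = uElt * tPow (m + n) := by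
  rw [mul_assoc, tPow_mul]

lemma uElt_mul_uElt (m n : ℤ) :
    uElt * tPow m * (uElt * tPow n) = tPow (m + n + 2) + (4 : ℂ) • tPow (m + n + 1) := by
  rw [mul_mul_mul_comm, uElt_mul_self, tPow_mul, add_mul, smul_mul_assoc, tPow_mul, tPow_mul,
    add_comm 2, add_comm 1]

/-! ### The vector field u d/dt and the residue pairing -/

/-- The linear map underlying the derivation `u d/dt`. -/
def ringDLin : Ring3 →ₗ[ℂ] Ring3 :=
  ringLift (fun n => (n : ℂ) • (uElt * tPow (n - 1)))
    -- Differentiating u² = t² + 4t gives u du/dt = t + 2, so u tⁿ goes to n u² tⁿ⁻¹ + (t + 2) tⁿ.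
    -- The factor u keeps the values inside R.
    (fun n => (n + 1 : ℂ) • tPow (n + 1) + (4 * n + 2 : ℂ) • tPow n)

lemma ringDLin_leibniz (a b : Ring3) :
    ringDLin (a * b) = a * ringDLin b + b * ringDLin a := by
  have := ring_bilin_eq_zero
    ((LinearMap.mul ℂ Ring3).compr₂ ringDLin - (LinearMap.mul ℂ Ring3).compl₂ ringDLin
      - ((LinearMap.mul ℂ Ring3).compl₂ ringDLin).flip) ?_ ?_ ?_ ?_ a b
  · simpa [sub_sub, sub_eq_zero] using this
  all_goals
    intro m n
    simp only [LinearMap.sub_apply, LinearMap.compr₂_apply, LinearMap.compl₂_apply,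
      LinearMap.flip_apply, LinearMap.mul_apply', tPow_mul, tPow_mul_uElt, uElt_mul_tPow,
      uElt_mul_uElt, map_add, map_smul]
    simp only [ringDLin, ringLift_tPow, ringLift_uElt_mul, mul_smul_comm, mul_add, tPow_mul,
      tPow_mul_uElt, uElt_mul_tPow, uElt_mul_uElt]
  · rw [show m + (n - 1) = m + n - 1 by ring, show n + (m - 1) = m + n - 1 by ring]
    push_cast; module
  · rw [show n + (m - 1) + 2 = m + n + 1 by ring, show m + (n + 1) = m + n + 1 by ring,
      show n + (m - 1) + 1 = m + n by ring]
    push_cast; module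
  · rw [show m + (n - 1) + 2 = m + n + 1 by ring, show n + (m + 1) = m + n + 1 by ring,
      show m + (n - 1) + 1 = m + n by ring, show n + m = m + n by ring]
    push_cast; module
  · rw [show m + n + 2 - 1 = m + n + 1 by ring, show m + n + 1 - 1 = m + n by ring,
      show m + (n + 1) = m + n + 1 by ring, show n + (m + 1) = m + n + 1 by ring,
      show n + m = m + n by ring]
    push_cast; module

/-- The derivation `u d/dt` of `R`. -/
def ringD : Derivation ℂ Ring3 Ring3 := Derivation.mk' ringDLin ringDLin_leibniz

lemma ringD_apply (a : Ring3) : ringD a = ringDLin a := rfl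

lemma ringD_tPow (n : ℤ) : ringD (tPow n) = (n : ℂ) • (uElt * tPow (n - 1)) :=
  (ringD_apply _).trans (ringLift_tPow _ _ n)

lemma ringD_uElt_mul (n : ℤ) :
    ringD (uElt * tPow n) = (n + 1 : ℂ) • tPow (n + 1) + (4 * n + 2 : ℂ) • tPow n :=
  (ringD_apply _).trans (ringLift_uElt_mul _ _ n)

/-- The coefficient of `u t⁻¹`. -/
def coeffU : Ring3 →ₗ[ℂ] ℂ := ringLift (fun _ => 0) (fun n => if n = -1 then 1 else 0)

lemma coeffU_tPow (n : ℤ) : coeffU (tPow n) = 0 := ringLift_tPow _ _ n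

lemma coeffU_uElt_mul (n : ℤ) : coeffU (uElt * tPow n) = if n = -1 then 1 else 0 :=
  ringLift_uElt_mul _ _ n

/-- The only way to reach u t⁻¹ is from t⁰, and there the factor n vanishes. Hence the coefficient
descends to differentials modulo exact ones. -/
lemma coeffU_ringD (a : Ring3) : coeffU (ringD a) = 0 := by
  induction a using ring_induction with
  | ht n =>
    rw [ringD_tPow, map_smul, coeffU_uElt_mul]
    split_ifs with h
    · simp [show n = 0 by omega]
    · simp
  | hu n =>
    rw [ringD_uElt_mul, coeffU.map_add, map_smul, map_smul, coeffU_tPow, coeffU_tPow]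
    simp
  | hadd a b ha hb => rw [ringD.map_add, coeffU.map_add, ha, hb, add_zero]
  | hsmul c a ha => rw [Derivation.map_smul, map_smul, ha, smul_zero]

/-- The linear functional on `Ω¹_R / dR` with `ω₀ ↦ 1`, `ω₁ ↦ 0`. -/
def residue : DiffModExact Ring3 →ₗ[ℂ] ℂ :=
  -- Contraction with u d/dt turns t⁻¹ dt into u t⁻¹, and t⁻¹ u dt into t + 4, which has no
  -- component along u t⁻¹.
  Submodule.liftQ _ (coeffU ∘ₗ ringD.liftKaehlerDifferential.restrictScalars ℂ) (by
    rintro _ ⟨a, rfl⟩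
    simp [coeffU_ringD])

lemma residue_diffClass (a b : Ring3) :
    residue (diffClass (a • KaehlerDifferential.D ℂ Ring3 b)) = coeffU (a * ringD b) := by
  simp [residue, diffClass]

/-- The residue of `a db`, as a bilinear form. -/
def resForm : Ring3 →ₗ[ℂ] Ring3 →ₗ[ℂ] ℂ :=
  ((LinearMap.mul ℂ Ring3).compl₂ (ringD : Ring3 →ₗ[ℂ] Ring3)).compr₂ coeffU

lemma resForm_apply (a b : Ring3) : resForm a b = coeffU (a * ringD b) := rfl

lemma resForm_swap (a b : Ring3) : resForm b a = -resForm a b := by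
  rw [eq_neg_iff_add_eq_zero, resForm_apply, resForm_apply, ← coeffU.map_add,
    add_comm (b * ringD a)]
  exact (congrArg coeffU (ringD.leibniz a b).symm).trans (coeffU_ringD _)

/-- The differentials on the two sides differ by d(abc). This identity matches the central terms
when [E,H] is bracketed with F. -/
lemma resForm_mul (a b c : Ring3) :
    resForm (a * b) c = resForm a (b * c) + resForm b (a * c) := by
  have h := coeffU_ringD (a * (b * c))
  have e : a * b * ringD c + ringD (a * (b * c)) = a * ringD (b * c) + b * ringD (a * c) := by
    simp only [Derivation.leibniz, smul_eq_mul]; ring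
  rw [resForm_apply, resForm_apply, resForm_apply, ← coeffU.map_add, ← e, coeffU.map_add, h,
    add_zero]

lemma resForm_tt (m n : ℤ) : resForm (tPow m) (tPow n) = if m + n = 0 then (n : ℂ) else 0 := by
  rw [resForm_apply, ringD_tPow, mul_smul_comm, tPow_mul_uElt, map_smul, coeffU_uElt_mul]
  simp [show m + (n - 1) = -1 ↔ m + n = 0 by omega]

lemma resForm_tu (m n : ℤ) : resForm (tPow m) (uElt * tPow n) = 0 := by
  rw [resForm_apply, ringD_uElt_mul, mul_add, mul_smul_comm, mul_smul_comm, tPow_mul, tPow_mul,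
    coeffU.map_add, map_smul, map_smul, coeffU_tPow, coeffU_tPow]
  simp

lemma resForm_ut (m n : ℤ) : resForm (uElt * tPow m) (tPow n) = 0 := by
  rw [resForm_swap, resForm_tu, neg_zero]

lemma resForm_uu (m n : ℤ) : resForm (uElt * tPow m) (uElt * tPow n) =
    (if m + n = -2 then (n + 1 : ℂ) else 0) + (if m + n = -1 then (4 * n + 2 : ℂ) else 0) := by
  simp only [resForm_apply, ringD_uElt_mul, mul_add, mul_smul_comm, uElt_mul_tPow, map_add,
    map_smul, coeffU_uElt_mul, show m + (n + 1) = -1 ↔ m + n = -2 by omega, smul_eq_mul, mul_ite,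
    mul_one, mul_zero]

lemma residue_omega0 : residue (omega0.2) = 1 := by
  rw [omega0, residue_diffClass, ← resForm_apply, resForm_tt]; simp

lemma residue_omega1 : residue (omega1.2) = 0 := by
  rw [omega1, residue_diffClass, ← resForm_apply, mul_comm (tPow (-1)), resForm_ut]

/-! ### The charge operator and the commutant of the modes of `α`, `α¹` -/

/-- The space `ℂ[y] ⊗ V`. -/
abbrev HeisSpace : Type := PolyY ⊗[ℂ] SpaceV

/-- The charge of a variable: `1` if the corresponding mode of `α` is an annihilation operator,
and `-1` otherwise. -/
def charge (r : Fin 2) (n : ℤ) : ℤ := if 0 ≤ n ∧ r = 0 then 1 else -1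

/-- The derivation of `ℂ[x]` measuring the charge. -/
def chargeD (r : Fin 2) : Derivation ℂ PolyX PolyX :=
  MvPolynomial.mkDerivation ℂ fun k => (charge r k.2 : ℂ) • MvPolynomial.X k

/-- The total charge of a monomial. -/
def monCharge (r : Fin 2) (s : Fin 2 × ℤ →₀ ℕ) : ℤ := s.sum fun k m => m * charge r k.2

lemma chargeD_monomial (r : Fin 2) (s : Fin 2 × ℤ →₀ ℕ) (c : ℂ) :
    chargeD r (MvPolynomial.monomial s c) = (monCharge r s : ℂ) • MvPolynomial.monomial s c := by
  rw [chargeD, MvPolynomial.mkDerivation_monomial, monCharge, Finsupp.sum, Finsupp.sum,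
    Int.cast_sum, Finset.sum_smul, Finset.smul_sum]
  refine Finset.sum_congr rfl fun k hk => ?_
  have hle : Finsupp.single k 1 ≤ s := by
    rw [Finsupp.single_le_iff]
    exact Nat.one_le_iff_ne_zero.mpr (Finsupp.mem_support_iff.mp hk)
  rw [smul_eq_mul, mul_smul_comm, MvPolynomial.X, MvPolynomial.monomial_mul,
    tsub_add_cancel_of_le hle, MvPolynomial.smul_monomial, MvPolynomial.smul_monomial,
    MvPolynomial.smul_monomial]
  push_cast
  simp only [smul_eq_mul]
  ring_nf

lemma coeff_chargeD (r : Fin 2) (s : Fin 2 × ℤ →₀ ℕ) (p : PolyX) :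
    (chargeD r p).coeff s = (monCharge r s : ℂ) * p.coeff s := by
  induction p using MvPolynomial.induction_on' with
  | monomial m c =>
    rw [chargeD_monomial, MvPolynomial.coeff_smul, MvPolynomial.coeff_monomial]
    split_ifs with h
    · rw [h, smul_eq_mul]
    · simp
  | add p q hp hq => rw [map_add, MvPolynomial.coeff_add, MvPolynomial.coeff_add, hp, hq, mul_add]

lemma monCharge_of_forall {r : Fin 2} {e : ℤ} {s : Fin 2 × ℤ →₀ ℕ}
    (h : ∀ k, s k ≠ 0 → charge r k.2 = e) : monCharge r s = e * s.degree := by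
  rw [monCharge, Finsupp.sum, Finsupp.degree_apply, Nat.cast_sum, Finset.mul_sum]
  refine Finset.sum_congr rfl fun k hk => ?_
  rw [h k (Finsupp.mem_support_iff.mp hk), mul_comm]

/-- A polynomial of charge `c ≥ 0` killed by the annihilation operators is constant, and `0` if
`c > 0`. -/
lemma polyX_eq_zero {r : Fin 2} {p : PolyX}
    (hd : ∀ k : Fin 2 × ℤ, 0 ≤ k.2 ∧ r = 0 → MvPolynomial.pderiv k p = 0) {c : ℕ}
    (hc : chargeD r p = (c : ℂ) • p) (h0 : c = 0 → p.coeff 0 = 0) : p = 0 := by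
  ext s
  rw [MvPolynomial.coeff_zero]
  by_contra hs
  have hk : ∀ k : Fin 2 × ℤ, s k ≠ 0 → charge r k.2 = -1 := fun k hk => by
    rw [charge, if_neg]
    intro hk'
    -- This coefficient of the derivative is a positive integer times the coefficient of p at s, so
    -- no annihilation variable can divide a monomial occurring in p.
    have := congrArg (MvPolynomial.coeff (s - Finsupp.single k 1)) (hd k hk')
    have hle : Finsupp.single k 1 ≤ s := by
      rw [Finsupp.single_le_iff]
      exact Nat.one_le_iff_ne_zero.mpr hk
    rw [MvPolynomial.coeff_pderiv, tsub_add_cancel_of_le hle, MvPolynomial.coeff_zero,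
      mul_eq_zero, or_iff_right hs] at this
    norm_cast at this
  -- All variables in s have charge -1, so the charge of s is minus its degree. It also equals c ≥
  -- 0, which forces s = 0 and c = 0.
  have hw := congrArg (MvPolynomial.coeff s) hc
  rw [coeff_chargeD, monCharge_of_forall hk, MvPolynomial.coeff_smul, smul_eq_mul] at hw
  have hw' := mul_right_cancel₀ hs hw
  have : (-1 * (s.degree : ℤ)) = c := by exact_mod_cast hw'
  have hs0 : s = 0 := (Finsupp.degree_eq_zero_iff s).mp (by omega)
  exact hs (hs0 ▸ h0 (by omega))

/-- The contraction of the second tensor factor with a functional. -/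
def slice (φ : HeisSpace →ₗ[ℂ] ℂ) : Fock →ₗ[ℂ] PolyX :=
  (TensorProduct.rid ℂ PolyX).toLinearMap ∘ₗ LinearMap.lTensor PolyX φ

lemma slice_tmul (φ : HeisSpace →ₗ[ℂ] ℂ) (p : PolyX) (w : HeisSpace) :
    slice φ (p ⊗ₜ w) = φ w • p := by
  simp [slice]

lemma slice_onX (φ : HeisSpace →ₗ[ℂ] ℂ) (S : Module.End ℂ PolyX) (v : Fock) :
    slice φ (onX S v) = S (slice φ v) := by
  induction v using TensorProduct.induction_on with
  | zero => simp
  | add v w hv hw => rw [map_add, map_add, map_add, map_add, hv, hw]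
  | tmul p w => rw [onX, LinearMap.rTensor_tmul, slice_tmul, slice_tmul, map_smul]

/-- The coordinates of v with respect to a basis of the second factor are slices. Statements about
vectors thus reduce to polynomials in ℂ[x]. -/
lemma eq_zero_of_slice {v : Fock} (h : ∀ φ, slice φ v = 0) : v = 0 := by
  classical
  apply (TensorProduct.equivFinsuppOfBasisRight (M := PolyX)
    (Module.Basis.ofVectorSpace ℂ HeisSpace)).injective
  rw [map_zero]
  ext1 i
  rw [TensorProduct.equivFinsuppOfBasisRight_apply]
  exact h _

/-- The projection to `ℂ[y] ⊗ V` setting all the variables of `ℂ[x]` to `0`. -/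
def vacProj : Fock →ₗ[ℂ] HeisSpace :=
  (TensorProduct.lid ℂ HeisSpace).toLinearMap ∘ₗ
    LinearMap.rTensor HeisSpace (MvPolynomial.lcoeff ℂ 0)

lemma vacProj_tmul (p : PolyX) (w : HeisSpace) : vacProj (p ⊗ₜ w) = p.coeff 0 • w := by
  simp [vacProj]

lemma coeff_slice (φ : HeisSpace →ₗ[ℂ] ℂ) (v : Fock) : (slice φ v).coeff 0 = φ (vacProj v) := by
  induction v using TensorProduct.induction_on with
  | zero => simp
  | add v w hv hw => rw [map_add, map_add, map_add, MvPolynomial.coeff_add, hv, hw]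
  | tmul p w =>
    rw [slice_tmul, vacProj_tmul, MvPolynomial.coeff_smul, map_smul, smul_eq_mul, smul_eq_mul,
      mul_comm]

lemma fock_eq_zero {r : Fin 2} {v : Fock}
    (hd : ∀ (i : Fin 2) (n : ℤ), 0 ≤ n ∧ r = 0 → xDer i n v = 0) {c : ℕ}
    (hc : onX (chargeD r : PolyX →ₗ[ℂ] PolyX) v = (c : ℂ) • v) (h0 : c = 0 → vacProj v = 0) :
    v = 0 := by
  refine eq_zero_of_slice fun φ => polyX_eq_zero (r := r) (c := c) ?_ ?_ ?_
  · rintro ⟨i, n⟩ hn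
    have := slice_onX φ (MvPolynomial.pderiv (i, n) : Derivation ℂ PolyX PolyX).toLinearMap v
    exact this.symm.trans (by rw [← xDer, hd i n hn, map_zero])
  · have := slice_onX φ (chargeD r : PolyX →ₗ[ℂ] PolyX) v
    rw [hc, map_smul] at this
    exact this.symm
  · intro h
    rw [coeff_slice, h0 h, map_zero]

/-- The charge operator. -/
def chargeOp (r : Fin 2) : Module.End ℂ Fock := onX (chargeD r : PolyX →ₗ[ℂ] PolyX)

lemma xMul_tmul (i : Fin 2) (n : ℤ) (p : PolyX) (w : HeisSpace) :
    xMul i n (p ⊗ₜ w) = (MvPolynomial.X (i, n) * p) ⊗ₜ w := rfl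

lemma xDer_tmul (i : Fin 2) (n : ℤ) (p : PolyX) (w : HeisSpace) :
    xDer i n (p ⊗ₜ w) = (MvPolynomial.pderiv (i, n) p) ⊗ₜ w := rfl

lemma chargeOp_tmul (r : Fin 2) (p : PolyX) (w : HeisSpace) :
    chargeOp r (p ⊗ₜ w) = (chargeD r p) ⊗ₜ w := rfl

/-- An operator of charge `d ≥ 0` commuting with the modes of `α`, `α¹` vanishes if `d > 0`, or if
its vacuum expectation is `0`. -/
theorem eq_zero_of_commute_oscA {r : Fin 2} {T : Module.End ℂ Fock}
    (ha : ∀ i n, adR (oscA r i n) T = 0) {d : ℕ} (hd : adR (chargeOp r) T = (-d : ℂ) • T)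
    (h0 : d = 0 → ∀ w, vacProj (T (1 ⊗ₜ w)) = 0) : T = 0 := by
  -- Induction on the degree of the monomial to which T is applied. In degree 0, the vacuum has
  -- charge 0 and is killed by the annihilation operators, so its image has charge d and is killed
  -- as well.
  have key : ∀ (N : ℕ) (s : Fin 2 × ℤ →₀ ℕ), s.degree = N → ∀ w : HeisSpace,
      T (MvPolynomial.monomial s 1 ⊗ₜ w) = 0 := by
    intro N
    induction N with
    | zero =>
      intro s hs w
      obtain rfl := (Finsupp.degree_eq_zero_iff s).mp hs
      change T (1 ⊗ₜ w) = 0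
      refine fock_eq_zero (r := r) (c := d) ?_ ?_ fun h => h0 h w
      · intro i n hn
        have := LinearMap.congr_fun (commute_of_adR_eq_zero (ha i n)) (1 ⊗ₜ w)
        rw [oscA, if_pos hn] at this
        simpa [xDer_tmul] using this.symm
      · have := LinearMap.congr_fun hd (1 ⊗ₜ w)
        rw [adR_apply, LinearMap.sub_apply, Module.End.mul_apply, Module.End.mul_apply,
          chargeOp_tmul, (chargeD r).map_one_eq_zero, TensorProduct.zero_tmul, map_zero, zero_sub,
          LinearMap.smul_apply, neg_smul, neg_inj] at this
        exact this
    | succ N ih =>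
      intro s hs w
      have hdeg (k) (hk : s k ≠ 0) : (s - Finsupp.single k 1).degree = N := by
        have hle : Finsupp.single k 1 ≤ s := by
          rw [Finsupp.single_le_iff]
          exact Nat.one_le_iff_ne_zero.mpr hk
        have := congrArg Finsupp.degree (tsub_add_cancel_of_le hle)
        rw [map_add, Finsupp.degree_single, hs] at this
        omega
      -- If s contains a variable whose multiplication operator is a mode of α, that variable can be
      -- pulled out through T, which lowers the degree.
      by_cases hk : ∃ k : Fin 2 × ℤ, s k ≠ 0 ∧ ¬ (0 ≤ k.2 ∧ r = 0)
      · obtain ⟨⟨i, n⟩, hk, hn⟩ := hk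
        have hle : Finsupp.single (i, n) 1 ≤ s := by
          rw [Finsupp.single_le_iff]
          exact Nat.one_le_iff_ne_zero.mpr hk
        have := LinearMap.congr_fun (commute_of_adR_eq_zero (ha i n))
          (MvPolynomial.monomial (s - Finsupp.single (i, n) 1) 1 ⊗ₜ w)
        rw [oscA, if_neg hn, Module.End.mul_apply, Module.End.mul_apply, xMul_tmul,
          ih _ (hdeg _ hk), map_zero, MvPolynomial.X, MvPolynomial.monomial_mul,
          add_tsub_cancel_of_le hle, one_mul] at this
        exact this
      · push Not at hk
        -- Now all variables in s have charge 1, so the charge of s is its degree N + 1 and the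
        -- image has charge N + 1 + d > 0. An annihilation operator passes through T and
        -- differentiates the monomial, so the induction hypothesis shows that the image is killed
        -- by it.
        refine fock_eq_zero (r := r) (c := N + 1 + d) ?_ ?_ fun h => by omega
        · intro i n hn
          have := LinearMap.congr_fun (commute_of_adR_eq_zero (ha i n))
            (MvPolynomial.monomial s 1 ⊗ₜ w)
          rw [oscA, if_pos hn, Module.End.mul_apply, Module.End.mul_apply, xDer_tmul,
            MvPolynomial.pderiv_monomial, one_mul] at this
          rw [← this]
          by_cases h : s (i, n) = 0
          · simp [h]
          · rw [← mul_one (s (i, n) : ℂ), ← smul_eq_mul, ← MvPolynomial.smul_monomial,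
              ← TensorProduct.smul_tmul', map_smul, ih _ (hdeg _ h), smul_zero]
        · have := LinearMap.congr_fun hd (MvPolynomial.monomial s 1 ⊗ₜ w)
          have hch : monCharge r s = 1 * s.degree := monCharge_of_forall fun k hs' => by
            rw [charge, if_pos (hk k hs')]
          rw [adR_apply, LinearMap.sub_apply, Module.End.mul_apply, Module.End.mul_apply,
            chargeOp_tmul, chargeD_monomial, ← TensorProduct.smul_tmul', map_smul, hch, hs,
            LinearMap.smul_apply, sub_eq_iff_eq_add] at this
          rw [← chargeOp, ← sub_eq_iff_eq_add'.mpr this]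
          push_cast
          module
  refine TensorProduct.ext' fun p w => ?_
  rw [LinearMap.zero_apply]
  induction p using MvPolynomial.induction_on' with
  | monomial s c =>
    rw [← mul_one c, ← smul_eq_mul, ← MvPolynomial.smul_monomial, ← TensorProduct.smul_tmul',
      map_smul, key _ s rfl w, smul_zero]
  | add p q hp hq => rw [TensorProduct.add_tmul, map_add, hp, hq, add_zero]

/-! ### Commutation relations of the oscillators -/

lemma onX_mul (S T : Module.End ℂ PolyX) : onX (S * T) = onX S * onX T :=
  LinearMap.rTensor_mul _ S T

lemma adR_onX (A S : Module.End ℂ PolyX) : adR (onX A) (onX S) = onX (adR A S) := by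
  rw [adR_apply, adR_apply, ← onX_mul, ← onX_mul]
  exact (LinearMap.rTensor_sub _ _).symm

section MvPolynomial

variable {σ : Type}

lemma adR_mulLeft_mulLeft (p q : MvPolynomial σ ℂ) :
    adR (LinearMap.mulLeft ℂ p) (LinearMap.mulLeft ℂ q) = 0 := by
  refine LinearMap.ext fun s => ?_
  simp only [adR_apply, LinearMap.sub_apply, Module.End.mul_apply, LinearMap.mulLeft_apply,
    LinearMap.zero_apply]
  ring

lemma adR_derivation (D D' : Derivation ℂ (MvPolynomial σ ℂ) (MvPolynomial σ ℂ)) :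
    adR D'.toLinearMap D.toLinearMap = ⁅D, D'⁆.toLinearMap := rfl

lemma adR_pderiv_pderiv (i j : σ) :
    adR (MvPolynomial.pderiv (R := ℂ) j).toLinearMap (MvPolynomial.pderiv i).toLinearMap = 0 := by
  classical
  refine (adR_derivation _ _).trans ?_
  rw [show ⁅MvPolynomial.pderiv (R := ℂ) i, MvPolynomial.pderiv j⁆ = 0
    from MvPolynomial.derivation_ext fun k => ?_]
  · rfl
  · rw [Derivation.commutator_apply, MvPolynomial.pderiv_X, MvPolynomial.pderiv_X]
    simp only [Pi.single_apply]
    split_ifs <;> simp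

lemma adR_mulLeft_pderiv [DecidableEq σ] (i j : σ) :
    adR (LinearMap.mulLeft ℂ (MvPolynomial.X j)) (MvPolynomial.pderiv (R := ℂ) i).toLinearMap =
      if i = j then 1 else 0 := by
  refine LinearMap.ext fun p => ?_
  change MvPolynomial.pderiv i (MvPolynomial.X j * p) -
    MvPolynomial.X j * MvPolynomial.pderiv i p = _
  rw [MvPolynomial.pderiv_mul, add_sub_cancel_right, MvPolynomial.pderiv_X, Pi.single_apply]
  by_cases h : i = j
  · rw [if_pos h, if_pos h.symm]; simp
  · rw [if_neg h, if_neg (Ne.symm h)]; simp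

end MvPolynomial

lemma adR_xMul_xMul (i j : Fin 2) (m n : ℤ) : adR (xMul j n) (xMul i m) = 0 := by
  rw [xMul, xMul, adR_onX, adR_mulLeft_mulLeft]
  exact LinearMap.rTensor_zero _

lemma adR_xDer_xDer (i j : Fin 2) (m n : ℤ) : adR (xDer j n) (xDer i m) = 0 := by
  rw [xDer, xDer, adR_onX]
  exact (congrArg onX (adR_pderiv_pderiv _ _)).trans (LinearMap.rTensor_zero _)

lemma adR_xMul_xDer (i j : Fin 2) (m n : ℤ) :
    adR (xMul j n) (xDer i m) = if i = j ∧ m = n then 1 else 0 := by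
  rw [xDer, xMul, adR_onX]
  refine (congrArg onX (adR_mulLeft_pderiv _ _)).trans ?_
  simp only [Prod.mk.injEq]
  split_ifs
  · exact LinearMap.rTensor_id _ _
  · exact LinearMap.rTensor_zero _

lemma adR_xDer_xMul (i j : Fin 2) (m n : ℤ) :
    adR (xDer j n) (xMul i m) = if i = j ∧ m = n then -1 else 0 := by
  rw [adR_swap, adR_xMul_xDer]
  simp only [eq_comm (a := j), eq_comm (a := n)]
  split_ifs <;> simp

lemma adR_chargeOp_xMul (r i : Fin 2) (n : ℤ) :
    adR (chargeOp r) (xMul i n) = (-charge r n : ℂ) • xMul i n := by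
  rw [chargeOp, xMul, adR_onX]
  refine Eq.trans (congrArg onX ?_) (LinearMap.rTensor_smul _ _ _)
  refine LinearMap.ext fun p => ?_
  change MvPolynomial.X (i, n) * chargeD r p - chargeD r (MvPolynomial.X (i, n) * p) =
    (-charge r n : ℂ) • (MvPolynomial.X (i, n) * p)
  rw [Derivation.leibniz, chargeD, MvPolynomial.mkDerivation_X]
  simp only [smul_eq_mul, neg_smul, mul_smul_comm]
  ring_nf

lemma adR_chargeOp_xDer (r i : Fin 2) (n : ℤ) :
    adR (chargeOp r) (xDer i n) = (charge r n : ℂ) • xDer i n := by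
  rw [chargeOp, xDer, adR_onX]
  refine Eq.trans (congrArg onX ?_) (LinearMap.rTensor_smul _ _ _)
  refine (adR_derivation _ _).trans ?_
  rw [show ⁅(MvPolynomial.pderiv (i, n) : Derivation ℂ PolyX PolyX), chargeD r⁆ =
    (charge r n : ℂ) • MvPolynomial.pderiv (i, n) from MvPolynomial.derivation_ext fun k => ?_]
  · rfl
  · rw [Derivation.commutator_apply, chargeD, MvPolynomial.mkDerivation_X, Derivation.map_smul,
      Derivation.smul_apply, MvPolynomial.pderiv_X, Pi.single_apply]
    split_ifs with h
    · subst h; simp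
    · simp

/-- For each index only one of the variable and its derivative is a mode of α, so no canonical pair
occurs. -/
lemma adR_oscA_oscA (r i l : Fin 2) (m n : ℤ) : adR (oscA r l n) (oscA r i m) = 0 := by
  simp only [oscA]
  split_ifs with h1 h2 h2
  · exact adR_xDer_xDer _ _ _ _
  · rw [adR_xDer_xMul, if_neg]; rintro ⟨-, rfl⟩; exact h2 h1
  · rw [adR_xMul_xDer, if_neg]; rintro ⟨-, rfl⟩; exact h1 h2
  · exact adR_xMul_xMul _ _ _ _

lemma adR_neg_left {M : Type} [AddCommGroup M] [Module ℂ M] (A T : Module.End ℂ M) :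
    adR (-A) T = -adR A T := by
  simp only [adR_apply]; noncomm_ring

lemma adR_alphaStar_alphaStar (r j k : Fin 2) (m n : ℤ) :
    adR (alphaStar r k n) (alphaStar r j m) = 0 := by
  simp only [alphaStar, oscAStar]
  split_ifs with h1 h2 h2
  · exact adR_xMul_xMul _ _ _ _
  · rw [map_neg, adR_xMul_xDer, if_neg, neg_zero]
    rintro ⟨-, h⟩; exact h2 ⟨by omega, h1.2⟩
  · rw [adR_neg_left, adR_xDer_xMul, if_neg, neg_zero]
    rintro ⟨-, h⟩; exact h1 ⟨by omega, h2.2⟩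
  · rw [adR_neg_left, map_neg, adR_xDer_xDer, neg_zero, neg_zero]

/-- The canonical commutator. The coefficient of index m is the mode of index m + 1 of α*, which
pairs with the mode n of α when m + 1 + n = 0. -/
lemma adR_oscA_alphaStar (r j l : Fin 2) (m n : ℤ) :
    adR (oscA r l n) (alphaStar r j m) =
      if m = -n - 1 then (if j = l then -1 else 0 : ℂ) • (1 : Module.End ℂ Fock) else 0 := by
  simp only [oscA, alphaStar, oscAStar]
  split_ifs with h1 h2 h3 h4 h3 h4 h2 h3 h4 h3 h4 <;> try omega
  all_goals
    simp only [map_neg, adR_xDer_xMul, adR_xMul_xMul, adR_xDer_xDer, adR_xMul_xDer, neg_zero,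
      zero_smul, neg_smul, one_smul]
  all_goals first | rfl | (split_ifs <;> first | rfl | omega)

lemma adR_chargeOp_oscA (r i : Fin 2) (n : ℤ) :
    adR (chargeOp r) (oscA r i n) = (1 : ℂ) • oscA r i n := by
  rw [oscA]
  split_ifs with h
  · rw [adR_chargeOp_xDer, charge, if_pos h, Int.cast_one]
  · rw [adR_chargeOp_xMul, charge, if_neg h]; simp

lemma adR_chargeOp_alphaStar (r j : Fin 2) (n : ℤ) :
    adR (chargeOp r) (alphaStar r j n) = (-1 : ℂ) • alphaStar r j n := by
  rw [alphaStar, oscAStar]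
  split_ifs with h
  · rw [adR_chargeOp_xMul, charge, if_pos ⟨by omega, h.2⟩, Int.cast_one]
  · rw [map_neg, adR_chargeOp_xDer, charge, if_neg fun h' => h ⟨by omega, h'.2⟩]; simp

/-! ### The splittings -/

lemma alphaSplit_plus (r i : Fin 2) (m : ℤ) :
    (alphaSplit r i).plus m = if 0 ≤ m ∧ r = 0 then 0 else oscA r i m := by
  rw [alphaSplit]
  by_cases hr : r = 0
  · simp only [hr, if_true, usualSplit, alpha, and_true]
    by_cases h : 0 ≤ m
    · rw [if_pos h, if_neg (by omega)]
    · rw [if_neg h, if_pos (by omega)]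
  · simp [hr, alpha]

lemma alphaSplit_minus (r i : Fin 2) (m : ℤ) :
    (alphaSplit r i).minus m = if 0 ≤ m ∧ r = 0 then oscA r i m else 0 := by
  rw [alphaSplit]
  by_cases hr : r = 0
  · simp only [hr, if_true, usualSplit, alpha, and_true]
  · simp [hr]

/-- The starred modes commute with one another, so the ordering is immaterial. -/
lemma normTerm_alphaStarSplit (r j k : Fin 2) (p m : ℤ) :
    normTerm (alphaStarSplit r j) (alphaStar r k) p m =
      plainTerm (alphaStar r j) (alphaStar r k) p m := by
  have hc := commute_of_adR_eq_zero (adR_alphaStar_alphaStar r k j (p - 1 - m) m)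
  rw [normTerm, plainTerm, alphaStarSplit]
  by_cases hr : r = 0
  · simp only [hr, if_true, usualSplit] at hc ⊢
    by_cases h : 0 ≤ m
    · rw [if_pos h, if_neg (by omega), zero_mul, zero_add, hc]
    · rw [if_neg h, if_pos (by omega), mul_zero, add_zero]
  · simp only [hr, if_false, Pi.zero_apply, zero_mul, zero_add, hc]

/-! ### Local finiteness -/

lemma xDer_finite (i : Fin 2) (v : Fock) : {n : ℤ | xDer i n v ≠ 0}.Finite := by
  induction v using TensorProduct.induction_on with
  | zero => simp
  | add v w hv hw =>
    refine (hv.union hw).subset fun n hn => ?_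
    by_contra hc
    simp only [Set.mem_union, Set.mem_ofPred_eq, not_or, not_not] at hc
    exact hn (by rw [map_add, hc.1, hc.2, add_zero])
  | tmul p w =>
    have hinj : Function.Injective fun n : ℤ => (i, n) := fun m n h => (Prod.mk.inj h).2
    refine (p.vars.finite_toSet.preimage hinj.injOn).subset fun n hn => ?_
    by_contra hc
    exact hn (by rw [xDer_tmul, MvPolynomial.pderiv_eq_zero_of_notMem_vars hc,
      TensorProduct.zero_tmul])

/-- On any given vector, the coefficients vanish for large indices, and if `r ≠ 0`, all but
finitely many of them vanish. -/
def Truncated (r : Fin 2) (b : Dist Fock) : Prop :=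
  ∀ v, BddAbove {m | b m v ≠ 0} ∧ (r ≠ 0 → BddBelow {m | b m v ≠ 0})

lemma alphaStar_truncated (r j : Fin 2) : Truncated r (alphaStar r j) := by
  intro v
  have hfin : {m : ℤ | xDer j (-(m + 1)) v ≠ 0}.Finite :=
    (xDer_finite j v).preimage fun m _ n _ h => by simpa using h
  constructor
  · refine (hfin.bddAbove.union (bddAbove_Iic (a := (-1 : ℤ)))).mono fun m hm => ?_
    by_contra hc
    simp only [Set.mem_union, Set.mem_ofPred_eq, not_or, not_not, Set.mem_Iic] at hc
    refine hm ?_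
    rw [alphaStar, oscAStar, if_neg (by omega), LinearMap.neg_apply, hc.1, neg_zero]
  · intro hr
    refine hfin.bddBelow.mono fun m hm => ?_
    intro h0
    refine hm ?_
    rw [alphaStar, oscAStar, if_neg fun h => hr h.2, LinearMap.neg_apply, h0, neg_zero]

/-- For r = 0 the plus half has m < 0, while truncation of b bounds m from below; the minus half
consists of derivatives, almost all of which kill a given vector. For r = 1 there is no minus half,
and b is truncated on both sides. -/
lemma normDefined_alphaSplit {r : Fin 2} (i : Fin 2) {b : Dist Fock} (h : Truncated r b) :
    NormDefined (alphaSplit r i) b := by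
  intro k v
  have h1 : {m : ℤ | ¬ (0 ≤ m ∧ r = 0) ∧ b (k - 1 - m) v ≠ 0}.Finite := by
    obtain ⟨N, hN⟩ := (h v).1
    by_cases hr : r = 0
    · refine (Set.finite_Icc (k - 1 - N) 0).subset ?_
      rintro m ⟨hm, hb⟩
      have := hN hb
      rw [Set.mem_Icc]
      constructor
      · omega
      · by_contra hc; exact hm ⟨by omega, hr⟩
    · obtain ⟨N', hN'⟩ := (h v).2 hr
      refine (Set.finite_Icc (k - 1 - N) (k - 1 - N')).subset ?_
      rintro m ⟨-, hb⟩
      have := hN hb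
      have := hN' hb
      rw [Set.mem_Icc]
      omega
  refine (h1.union (xDer_finite i v)).subset fun m hm => ?_
  by_contra hc
  simp only [Set.mem_union, Set.mem_ofPred_eq, not_or, not_not, not_and] at hc
  refine hm ?_
  change normTerm _ _ _ _ _ = 0
  rw [normTerm, alphaSplit_plus, alphaSplit_minus]
  by_cases hS : 0 ≤ m ∧ r = 0
  · rw [if_pos hS, if_pos hS, oscA, if_pos hS]; simp [hc.2]
  · rw [if_neg hS, if_neg hS, mul_zero, add_zero, Module.End.mul_apply, hc.1 (by simpa using hS),
      map_zero]

/-- Because the factors commute, either may act first: b kills the vector when m is large, α* kills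
it when m is very negative. -/
lemma plainDefined_alphaStar {r : Fin 2} (j : Fin 2) {b : Dist Fock}
    (hb : ∀ v, BddAbove {m | b m v ≠ 0})
    (hc : ∀ m n, adR (alphaStar r j n) (b m) = 0) : PlainDefined b (alphaStar r j) := by
  intro k v
  obtain ⟨N, hN⟩ := hb v
  obtain ⟨N', hN'⟩ := (alphaStar_truncated r j v).1
  refine (Set.finite_Icc (k - 1 - N') N).subset fun m hm => ?_
  rw [Set.mem_Icc]
  by_contra hcon
  refine hm ?_
  change plainTerm _ _ _ _ _ = 0
  rw [plainTerm]
  by_cases h : N < m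
  · have : b m v = 0 := by
      by_contra h0
      have := hN h0
      omega
    rw [commute_of_adR_eq_zero (hc m _), Module.End.mul_apply, this, map_zero]
  · have : alphaStar r j (k - 1 - m) v = 0 := by
      by_contra h0
      have := hN' h0
      omega
    rw [Module.End.mul_apply, this, map_zero]

lemma plainDefined_alphaStar_alphaStar (r j k : Fin 2) :
    PlainDefined (alphaStar r j) (alphaStar r k) :=
  plainDefined_alphaStar k (fun v => (alphaStar_truncated r j v).1)
    fun m n => adR_alphaStar_alphaStar r j k m n

lemma normDefined_alphaStarSplit (r j k : Fin 2) :
    NormDefined (alphaStarSplit r j) (alphaStar r k) := fun p => by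
  rw [funext (normTerm_alphaStarSplit r j k p)]
  exact plainDefined_alphaStar_alphaStar r j k p

lemma starQuad_eq_plainProd (r j k : Fin 2) :
    starQuad r j k = plainProd (alphaStar r j) (alphaStar r k) := by
  funext p
  rw [starQuad, normProd, funext (normTerm_alphaStarSplit r j k p)]
  rfl

lemma starQuad_truncated (r j k : Fin 2) : Truncated r (starQuad r j k) := by
  intro v
  have key : ∀ p, starQuad r j k p v ≠ 0 → ∃ m, alphaStar r j m v ≠ 0 ∧
      alphaStar r k (p - 1 - m) v ≠ 0 := by
    intro p hp
    by_contra hc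
    push Not at hc
    refine hp ?_
    rw [starQuad_eq_plainProd, plainProd, locSum_apply (plainDefined_alphaStar_alphaStar r j k p)]
    refine finsum_eq_zero_of_forall_eq_zero fun m => ?_
    rw [plainTerm]
    by_cases h : alphaStar r j m v = 0
    · rw [commute_of_adR_eq_zero (adR_alphaStar_alphaStar r j k _ _), Module.End.mul_apply, h,
        map_zero]
    · rw [Module.End.mul_apply, hc m h, map_zero]
  constructor
  · obtain ⟨N, hN⟩ := (alphaStar_truncated r j v).1
    obtain ⟨N', hN'⟩ := (alphaStar_truncated r k v).1
    refine ⟨N + N' + 1, fun p hp => ?_⟩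
    obtain ⟨m, h1, h2⟩ := key p hp
    have := hN h1
    have := hN' h2
    omega
  · intro hr
    obtain ⟨N, hN⟩ := (alphaStar_truncated r j v).2 hr
    obtain ⟨N', hN'⟩ := (alphaStar_truncated r k v).2 hr
    refine ⟨N + N' + 1, fun p hp => ?_⟩
    obtain ⟨m, h1, h2⟩ := key p hp
    have := hN h1
    have := hN' h2
    omega

lemma quad_defined (r i j : Fin 2) : NormDefined (alphaSplit r i) (alphaStar r j) :=
  normDefined_alphaSplit i (alphaStar_truncated r j)

lemma cubic_defined (r i j k : Fin 2) : NormDefined (alphaSplit r i) (starQuad r j k) :=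
  normDefined_alphaSplit i (starQuad_truncated r j k)

/-! ### Commutators of the normal ordered products with the modes of `α`, `α¹` -/

lemma adR_oscA_plus (r i l : Fin 2) (m n : ℤ) :
    adR (oscA r l n) ((alphaSplit r i).plus m) = 0 := by
  rw [alphaSplit_plus]
  split_ifs
  · exact map_zero _
  · exact adR_oscA_oscA _ _ _ _ _

lemma adR_oscA_minus (r i l : Fin 2) (m n : ℤ) :
    adR (oscA r l n) ((alphaSplit r i).minus m) = 0 := by
  rw [alphaSplit_minus]
  split_ifs
  · exact adR_oscA_oscA _ _ _ _ _
  · exact map_zero _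

lemma adR_chargeOp_plus (r i : Fin 2) (m : ℤ) :
    adR (chargeOp r) ((alphaSplit r i).plus m) = (1 : ℂ) • (alphaSplit r i).plus m := by
  rw [alphaSplit_plus]
  split_ifs
  · simp
  · exact adR_chargeOp_oscA _ _ _

lemma adR_chargeOp_minus (r i : Fin 2) (m : ℤ) :
    adR (chargeOp r) ((alphaSplit r i).minus m) = (1 : ℂ) • (alphaSplit r i).minus m := by
  rw [alphaSplit_minus]
  split_ifs
  · exact adR_chargeOp_oscA _ _ _
  · simp

/-- Contracting the starred factor leaves a single coefficient, and the two halves of α then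
recombine to a full mode. -/
lemma adR_oscA_quad (r i j l : Fin 2) (p n : ℤ) :
    adR (oscA r l n) (quad r i j p) = (if j = l then -1 else 0 : ℂ) • oscA r i (p + n) := by
  rw [quad, adR_normProd (fun m => adR_oscA_plus r i l m n) (fun m => adR_oscA_minus r i l m n)
    (quad_defined r i j), funext fun m => adR_oscA_alphaStar r j l m n, normProd_single,
    alphaSplit_plus, alphaSplit_minus, show p - 1 - (-n - 1) = p + n by ring]
  split_ifs <;> simp

lemma adR_oscA_starQuad (r j k l : Fin 2) (p n : ℤ) :
    adR (oscA r l n) (starQuad r j k p) =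
      (if j = l then -1 else 0 : ℂ) • alphaStar r k (p + n) +
        (if k = l then -1 else 0 : ℂ) • alphaStar r j (p + n) := by
  have hs1 : ∀ m, m ≠ p + n →
      alphaStar r j m * adR (oscA r l n) (alphaStar r k (p - 1 - m)) = 0 := fun m hm => by
    rw [adR_oscA_alphaStar, if_neg (by omega), mul_zero]
  have hs2 : ∀ m, m ≠ -n - 1 →
      adR (oscA r l n) (alphaStar r j m) * alphaStar r k (p - 1 - m) = 0 := fun m hm => by
    rw [adR_oscA_alphaStar, if_neg (by omega), zero_mul]
  rw [starQuad_eq_plainProd, adR_plainProd (plainDefined_alphaStar_alphaStar r j k),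
    locSum_add (locallyFinite_of_single hs1) (locallyFinite_of_single hs2),
    locSum_eq_single _ hs1, locSum_eq_single _ hs2, adR_oscA_alphaStar, adR_oscA_alphaStar,
    if_pos (by ring), if_pos rfl, show p - 1 - (-n - 1) = p + n by ring]
  rw [mul_smul_comm, smul_mul_assoc, mul_one, one_mul, add_comm]

lemma adR_oscA_cubic (r i j k l : Fin 2) (p n : ℤ) :
    adR (oscA r l n) (cubic r i j k p) =
      (if j = l then -1 else 0 : ℂ) • quad r i k (p + n) +
        (if k = l then -1 else 0 : ℂ) • quad r i j (p + n) := by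
  rw [cubic, adR_normProd (fun m => adR_oscA_plus r i l m n) (fun m => adR_oscA_minus r i l m n)
    (cubic_defined r i j k), funext fun m => adR_oscA_starQuad r j k l m n,
    normProd_add (((quad_defined r i k).comp_add n).smul _)
      (((quad_defined r i j).comp_add n).smul _),
    normProd_smul ((quad_defined r i k).comp_add n),
    normProd_smul ((quad_defined r i j).comp_add n), normProd_comp_add, normProd_comp_add]
  rfl

lemma adR_chargeOp_quad (r i j : Fin 2) (p : ℤ) : adR (chargeOp r) (quad r i j p) = 0 := by
  rw [quad, adR_normProd_of_weight (adR_chargeOp_plus r i) (adR_chargeOp_minus r i)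
    (adR_chargeOp_alphaStar r j) (quad_defined r i j), add_neg_cancel, zero_smul]

lemma adR_chargeOp_starQuad (r j k : Fin 2) (p : ℤ) :
    adR (chargeOp r) (starQuad r j k p) = (-2 : ℂ) • starQuad r j k p := by
  rw [starQuad_eq_plainProd, adR_plainProd (plainDefined_alphaStar_alphaStar r j k), plainProd,
    ← locSum_smul (plainDefined_alphaStar_alphaStar r j k p)]
  congr 1; ext1 m
  rw [adR_chargeOp_alphaStar, adR_chargeOp_alphaStar, plainTerm, mul_smul_comm, smul_mul_assoc]
  module

lemma adR_chargeOp_cubic (r i j k : Fin 2) (p : ℤ) :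
    adR (chargeOp r) (cubic r i j k p) = (-1 : ℂ) • cubic r i j k p := by
  rw [cubic, adR_normProd_of_weight (adR_chargeOp_plus r i) (adR_chargeOp_minus r i)
    (adR_chargeOp_starQuad r j k) (cubic_defined r i j k)]
  norm_num

/-! ### The Heisenberg fields -/

section

variable {M : Type} [AddCommGroup M] [Module ℂ M]

lemma adR_add_left (A B T : Module.End ℂ M) : adR (A + B) T = adR A T + adR B T := by
  simp only [adR_apply]; noncomm_ring

lemma adR_smul_left (c : ℂ) (A T : Module.End ℂ M) : adR (c • A) T = c • adR A T := by
  simp only [adR_apply, mul_smul_comm, smul_mul_assoc, smul_sub]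

lemma adR_one_left (T : Module.End ℂ M) : adR 1 T = 0 := by
  simp [adR_apply]

lemma adR_zero_left (T : Module.End ℂ M) : adR 0 T = 0 := by
  simp [adR_apply]

lemma adR_self (T : Module.End ℂ M) : adR T T = 0 := sub_self _

end

/-- An operator on `ℂ[y] ⊗ V`, acting on the last tensor factors. -/
def onW (S : Module.End ℂ HeisSpace) : Module.End ℂ Fock := LinearMap.lTensor PolyX S

lemma onW_tmul (S : Module.End ℂ HeisSpace) (p : PolyX) (w : HeisSpace) :
    onW S (p ⊗ₜ w) = p ⊗ₜ S w := rfl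

lemma adR_onX_onW (A : Module.End ℂ PolyX) (S : Module.End ℂ HeisSpace) :
    adR (onX A) (onW S) = 0 := by
  refine TensorProduct.ext' fun p w => ?_
  rw [adR_apply, LinearMap.sub_apply, LinearMap.zero_apply]
  exact sub_self _

/-- A family of operators on `ℂ[y] ⊗ V`, vanishing on any given vector for large indices. -/
structure IsHeisField (β : Dist Fock) : Prop where
  exists_onW : ∀ n, ∃ S, β n = onW S
  bddAbove : ∀ v, BddAbove {m | β m v ≠ 0}

lemma IsHeisField.adR_onX {β : Dist Fock} (hβ : IsHeisField β) (A : Module.End ℂ PolyX) (n : ℤ) :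
    adR (onX A) (β n) = 0 := by
  obtain ⟨S, hS⟩ := hβ.exists_onW n
  rw [hS, adR_onX_onW]

lemma oscA_eq_onX (r i : Fin 2) (n : ℤ) : ∃ A, oscA r i n = onX A := by
  rw [oscA]; split_ifs <;> exact ⟨_, rfl⟩

lemma alphaStar_eq_onX (r j : Fin 2) (n : ℤ) : ∃ A, alphaStar r j n = onX A := by
  rw [alphaStar, oscAStar]
  split_ifs
  · exact ⟨_, rfl⟩
  · exact ⟨-(MvPolynomial.pderiv (R := ℂ) (j, -(n + 1))).toLinearMap,
      (LinearMap.rTensor_neg _).symm⟩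

lemma IsHeisField.adR_oscA {β : Dist Fock} (hβ : IsHeisField β) (r i : Fin 2) (m n : ℤ) :
    adR (oscA r i m) (β n) = 0 := by
  obtain ⟨A, hA⟩ := oscA_eq_onX r i m
  rw [hA, hβ.adR_onX]

lemma IsHeisField.adR_alphaStar {β : Dist Fock} (hβ : IsHeisField β) (r i : Fin 2) (m n : ℤ) :
    adR (alphaStar r i m) (β n) = 0 := by
  obtain ⟨A, hA⟩ := alphaStar_eq_onX r i m
  rw [hA, hβ.adR_onX]

lemma IsHeisField.plainDefined {β : Dist Fock} (hβ : IsHeisField β) (r j : Fin 2) :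
    PlainDefined β (alphaStar r j) :=
  plainDefined_alphaStar j hβ.bddAbove fun m n => hβ.adR_alphaStar r j n m

lemma IsHeisField.adR_oscA_plainProd {β : Dist Fock} (hβ : IsHeisField β) (r j l : Fin 2)
    (p n : ℤ) : adR (oscA r l n) (plainProd β (alphaStar r j) p) =
      (if j = l then -1 else 0 : ℂ) • β (p + n) := by
  rw [adR_plainProd_single (hβ.plainDefined r j) (fun m => hβ.adR_oscA r l n m)
    (fun m => adR_oscA_alphaStar r j l m n), show p - 1 - (-n - 1) = p + n by ring]

lemma IsHeisField.adR_chargeOp_plainProd {β : Dist Fock} (hβ : IsHeisField β) (r j : Fin 2)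
    (p : ℤ) : adR (chargeOp r) (plainProd β (alphaStar r j) p) =
      (-1 : ℂ) • plainProd β (alphaStar r j) p :=
  adR_plainProd_of_weight (hβ.plainDefined r j) (fun m => hβ.adR_onX _ m)
    (adR_chargeOp_alphaStar r j) p

/-! Multiplication by a variable of `ℂ[y]`, and its partial derivative, extended by `0` to all
indices. -/

/-- Multiplication by `y_n`, or `0` if `n ≥ 0`. -/
def yMul₀ (i : Fin 2) (n : ℤ) : Module.End ℂ Fock := if h : n < 0 then yMul i n h else 0

/-- The partial derivative with respect to `y_n`, or `0` if `n ≥ 0`. -/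
def yDer₀ (i : Fin 2) (n : ℤ) : Module.End ℂ Fock := if h : n < 0 then yDer i n h else 0

lemma yMul₀_of_neg {i : Fin 2} {n : ℤ} (h : n < 0) : yMul₀ i n = yMul i n h := dif_pos h

lemma yMul₀_of_nonneg {i : Fin 2} {n : ℤ} (h : 0 ≤ n) : yMul₀ i n = 0 := dif_neg (by omega)

lemma yDer₀_of_neg {i : Fin 2} {n : ℤ} (h : n < 0) : yDer₀ i n = yDer i n h := dif_pos h

lemma yDer₀_of_nonneg {i : Fin 2} {n : ℤ} (h : 0 ≤ n) : yDer₀ i n = 0 := dif_neg (by omega)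

lemma onY_mul (S T : Module.End ℂ PolyY) : onY (S * T) = onY S * onY T := by
  rw [onY, onY, onY, ← LinearMap.lTensor_mul, ← LinearMap.rTensor_mul]

lemma onY_sub (S T : Module.End ℂ PolyY) : onY (S - T) = onY S - onY T := by
  rw [onY, onY, onY, ← LinearMap.lTensor_sub, ← LinearMap.rTensor_sub]

lemma onY_zero : onY 0 = 0 := by
  rw [onY, LinearMap.rTensor_zero, LinearMap.lTensor_zero]

lemma onY_one : onY 1 = 1 :=
  (congrArg (LinearMap.lTensor PolyX) (LinearMap.rTensor_id _ _)).trans (LinearMap.lTensor_id _ _)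

lemma adR_onY (A S : Module.End ℂ PolyY) : adR (onY A) (onY S) = onY (adR A S) := by
  rw [adR_apply, adR_apply, ← onY_mul, ← onY_mul, onY_sub]

lemma adR_onV_onY (A : Module.End ℂ SpaceV) (S : Module.End ℂ PolyY) :
    adR (onV A) (onY S) = 0 := by
  refine TensorProduct.ext_threefold' fun p q v => ?_
  rw [adR_apply, LinearMap.sub_apply, LinearMap.zero_apply]
  exact sub_self _

lemma yMul₀_eq_onY (i : Fin 2) (n : ℤ) : ∃ S, yMul₀ i n = onY S := by
  rw [yMul₀]
  split_ifs
  · exact ⟨_, rfl⟩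
  · exact ⟨0, onY_zero.symm⟩

lemma yDer₀_eq_onY (i : Fin 2) (n : ℤ) : ∃ S, yDer₀ i n = onY S := by
  rw [yDer₀]
  split_ifs
  · exact ⟨_, rfl⟩
  · exact ⟨0, onY_zero.symm⟩

lemma adR_onV_yMul₀ (A : Module.End ℂ SpaceV) (i : Fin 2) (n : ℤ) :
    adR (onV A) (yMul₀ i n) = 0 := by
  obtain ⟨S, hS⟩ := yMul₀_eq_onY i n
  rw [hS, adR_onV_onY]

lemma adR_onV_yDer₀ (A : Module.End ℂ SpaceV) (i : Fin 2) (n : ℤ) :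
    adR (onV A) (yDer₀ i n) = 0 := by
  obtain ⟨S, hS⟩ := yDer₀_eq_onY i n
  rw [hS, adR_onV_onY]

lemma adR_yMul₀_onV (A : Module.End ℂ SpaceV) (i : Fin 2) (n : ℤ) :
    adR (yMul₀ i n) (onV A) = 0 := by
  rw [adR_swap, adR_onV_yMul₀, neg_zero]

lemma adR_yDer₀_onV (A : Module.End ℂ SpaceV) (i : Fin 2) (n : ℤ) :
    adR (yDer₀ i n) (onV A) = 0 := by
  rw [adR_swap, adR_onV_yDer₀, neg_zero]

lemma adR_yMul₀_yMul₀ (i j : Fin 2) (m n : ℤ) : adR (yMul₀ j n) (yMul₀ i m) = 0 := by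
  rw [yMul₀, yMul₀]
  split_ifs
  · rw [yMul, yMul, adR_onY, adR_mulLeft_mulLeft, onY_zero]
  · rw [map_zero]
  · rw [adR_zero_left]
  · rw [map_zero]

lemma adR_yDer₀_yDer₀ (i j : Fin 2) (m n : ℤ) : adR (yDer₀ j n) (yDer₀ i m) = 0 := by
  rw [yDer₀, yDer₀]
  split_ifs
  · rw [yDer, yDer, adR_onY]
    exact (congrArg onY (adR_pderiv_pderiv _ _)).trans onY_zero
  · rw [map_zero]
  · rw [adR_zero_left]
  · rw [map_zero]

lemma adR_yMul₀_yDer₀ (i j : Fin 2) (m n : ℤ) :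
    adR (yMul₀ j n) (yDer₀ i m) = (if i = j ∧ m = n ∧ n < 0 then 1 else 0 : ℂ) • 1 := by
  rw [yMul₀, yDer₀]
  split_ifs with h1 h2 h3 h3 h4 h3 <;> try omega
  · rw [yDer, yMul, adR_onY]
    obtain ⟨rfl, rfl, -⟩ := h3
    refine (congrArg onY (adR_mulLeft_pderiv _ _)).trans ?_
    rw [if_pos rfl, onY_one, one_smul]
  · rw [yDer, yMul, adR_onY]
    refine (congrArg onY (adR_mulLeft_pderiv _ _)).trans ?_
    rw [if_neg, onY_zero, zero_smul]
    intro h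
    simp only [Prod.mk.injEq, Subtype.mk.injEq] at h
    exact h3 ⟨h.1, h.2, h1⟩
  all_goals simp [adR_zero_left]

lemma adR_yDer₀_yMul₀ (i j : Fin 2) (m n : ℤ) :
    adR (yDer₀ j n) (yMul₀ i m) = (if j = i ∧ n = m ∧ m < 0 then -1 else 0 : ℂ) • 1 := by
  rw [adR_swap, adR_yMul₀_yDer₀]
  split_ifs <;> simp

/-- With the variables and derivatives extended by zero, one formula covers all n, and case
distinctions in the commutators are confined to scalars. -/
lemma heis_eq (lam κ₀ : ℂ) (n : ℤ) : heis lam κ₀ 0 n =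
    yMul₀ 0 n + (-2 * n * κ₀ : ℂ) • yDer₀ 0 (-n) + (if n = 0 then lam else 0) • 1 := by
  rw [heis]
  split_ifs with h h0
  · omega
  · rw [yMul₀_of_neg h, yDer₀_of_nonneg (by omega)]; simp
  · rw [yMul₀_of_nonneg (by omega), yDer₀_of_nonneg (by omega)]; simp
  · rw [yMul₀_of_nonneg (by omega), yDer₀_of_neg (by omega)]; simp

lemma heis1_eq (mu nu kap κ₀ : ℂ) (n : ℤ) : heis1 mu nu kap κ₀ 0 n =
    yMul₀ 1 n + (-2 * (n + 1) * κ₀ : ℂ) • yDer₀ 1 (-n - 2) +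
      (-4 * (2 * n + 1) * κ₀ : ℂ) • yDer₀ 1 (-n - 1) +
      (if n = 0 then 1 else 0 : ℂ) • onV (opB mu nu kap) := by
  rw [heis1]
  split_ifs with h h0 h0
  · omega
  · rw [yMul₀_of_neg h, yDer₀_of_nonneg (n := -n - 1) (by omega)]
    -- For n = -1 the index -n - 2 is still negative, so the derivative itself is not zero; its
    -- coefficient n + 1 is.
    by_cases h1 : n = -1
    · subst h1; simp
    · rw [yDer₀_of_nonneg (n := -n - 2) (by omega)]; simp
  · subst h0
    rw [yMul₀_of_nonneg le_rfl, yDer₀_of_neg (by omega), yDer₀_of_neg (by omega)]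
    simp
  · rw [yMul₀_of_nonneg (by omega), yDer₀_of_neg (by omega), yDer₀_of_neg (by omega)]; simp

lemma adR_heis_heis (lam κ₀ : ℂ) (m n : ℤ) : adR (heis lam κ₀ 0 n) (heis lam κ₀ 0 m) =
    (if m + n = 0 then 2 * n * κ₀ else 0 : ℂ) • 1 := by
  simp only [heis_eq, map_add, map_smul, adR_add_left, adR_smul_left, adR_one_left, adR_one,
    adR_yMul₀_yMul₀, adR_yDer₀_yDer₀, adR_yMul₀_yDer₀, adR_yDer₀_yMul₀, smul_zero, add_zero,
    zero_add, smul_smul, ← add_smul, true_and]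
  congr 1
  by_cases h : m + n = 0
  · obtain rfl : m = -n := by omega
    rcases lt_trichotomy n 0 with hn | rfl | hn
    · rw [if_neg (by omega), if_pos ⟨by omega, by omega⟩, if_pos h]; push_cast; ring
    · simp
    · rw [if_pos ⟨by omega, by omega⟩, if_neg (by omega), if_pos h]; push_cast; ring
  · rw [if_neg (by omega), if_neg (by omega), if_neg h]; ring

lemma adR_heis1_heis (lam mu nu kap κ₀ : ℂ) (m n : ℤ) :
    adR (heis1 mu nu kap κ₀ 0 n) (heis lam κ₀ 0 m) = 0 := by
  simp only [heis_eq, heis1_eq, map_add, map_smul, adR_add_left, adR_smul_left, adR_one,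
    adR_yMul₀_yMul₀, adR_yDer₀_yDer₀, adR_yMul₀_yDer₀, adR_yDer₀_yMul₀, adR_onV_yMul₀,
    adR_onV_yDer₀]
  simp

/-- The two derivatives in a mode pair with the variables of index -n - 2 and -n - 1, which gives
the two central terms. The operator on V commutes with everything else that occurs, and with itself.
-/
lemma adR_heis1_heis1 (mu nu kap κ₀ : ℂ) (m n : ℤ) :
    adR (heis1 mu nu kap κ₀ 0 n) (heis1 mu nu kap κ₀ 0 m) =
      ((if m + n = -2 then 2 * (n + 1) * κ₀ else 0 : ℂ) +
        (if m + n = -1 then 4 * (2 * n + 1) * κ₀ else 0)) • 1 := by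
  simp only [heis1_eq, map_add, map_smul, adR_add_left, adR_smul_left,
    adR_yMul₀_yMul₀, adR_yDer₀_yDer₀, adR_yMul₀_yDer₀, adR_yDer₀_yMul₀, adR_onV_yMul₀,
    adR_onV_yDer₀, adR_yMul₀_onV, adR_yDer₀_onV, adR_self, smul_zero, add_zero,
    zero_add, smul_smul, ← add_smul, true_and]
  congr 1
  by_cases h2 : m + n = -2
  · obtain rfl : m = -n - 2 := by omega
    rw [if_neg (c := -n - 2 + n = -1) (by omega), if_neg (c := -n - 1 = -n - 2 ∧ _) (by omega),
      if_neg (c := -(-n - 2) - 1 = n ∧ _) (by omega), if_pos h2]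
    rcases lt_trichotomy n (-1) with hn | rfl | hn
    · rw [if_neg (by omega), if_pos ⟨by omega, by omega⟩]; push_cast; ring
    · simp
    · rw [if_pos ⟨rfl, by omega⟩, if_neg (by omega)]; push_cast; ring
  · rw [if_neg (c := m + n = -2) h2, if_neg (c := -n - 2 = m ∧ _) (by omega),
      if_neg (c := -m - 2 = n ∧ _) (by omega)]
    by_cases h1 : m + n = -1
    · obtain rfl : m = -n - 1 := by omega
      rw [if_pos h1]
      by_cases hn : n < 0
      · rw [if_neg (by omega), if_pos ⟨by omega, hn⟩]; push_cast; ring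
      · rw [if_pos ⟨rfl, by omega⟩, if_neg (by omega)]; push_cast; ring
    · rw [if_neg (by omega), if_neg (by omega), if_neg h1]; ring

/-! ### Local finiteness of the Heisenberg fields -/

lemma yDer₀_finite (i : Fin 2) (v : Fock) : {n : ℤ | yDer₀ i n v ≠ 0}.Finite := by
  have hadd : ∀ v w : Fock, {n : ℤ | yDer₀ i n v ≠ 0}.Finite → {n : ℤ | yDer₀ i n w ≠ 0}.Finite →
      {n : ℤ | yDer₀ i n (v + w) ≠ 0}.Finite := fun v w hv hw => by
    refine (hv.union hw).subset fun n hn => ?_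
    by_contra hc
    simp only [Set.mem_union, Set.mem_ofPred_eq, not_or, not_not] at hc
    exact hn (by rw [map_add, hc.1, hc.2, add_zero])
  induction v using TensorProduct.induction_on with
  | zero => simp
  | add v w hv hw => exact hadd v w hv hw
  | tmul p w =>
    induction w using TensorProduct.induction_on with
    | zero => simp
    | add v w hv hw => rw [TensorProduct.tmul_add]; exact hadd _ _ hv hw
    | tmul q z =>
      refine (q.vars.finite_toSet.image fun k => k.2.1).subset fun n hn => ?_
      by_contra hc
      refine hn ?_
      by_cases h : n < 0
      · rw [yDer₀_of_neg h]
        change p ⊗ₜ (MvPolynomial.pderiv (i, ⟨n, h⟩) q ⊗ₜ z) = 0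
        rw [MvPolynomial.pderiv_eq_zero_of_notMem_vars, TensorProduct.zero_tmul,
          TensorProduct.tmul_zero]
        exact fun hm => hc ⟨_, hm, rfl⟩
      · rw [yDer₀_of_nonneg (by omega), LinearMap.zero_apply]

lemma exists_onW_add {S T : Module.End ℂ Fock} (hS : ∃ S', S = onW S') (hT : ∃ T', T = onW T') :
    ∃ U, S + T = onW U := by
  obtain ⟨S', rfl⟩ := hS
  obtain ⟨T', rfl⟩ := hT
  exact ⟨S' + T', (LinearMap.lTensor_add _ _ _).symm⟩

lemma exists_onW_smul (c : ℂ) {S : Module.End ℂ Fock} (hS : ∃ S', S = onW S') :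
    ∃ U, c • S = onW U := by
  obtain ⟨S', rfl⟩ := hS
  exact ⟨c • S', (LinearMap.lTensor_smul _ _ _).symm⟩

lemma yMul₀_eq_onW (i : Fin 2) (n : ℤ) : ∃ S, yMul₀ i n = onW S := by
  obtain ⟨S, hS⟩ := yMul₀_eq_onY i n
  exact ⟨_, hS⟩

lemma yDer₀_eq_onW (i : Fin 2) (n : ℤ) : ∃ S, yDer₀ i n = onW S := by
  obtain ⟨S, hS⟩ := yDer₀_eq_onY i n
  exact ⟨_, hS⟩

lemma one_eq_onW : ∃ S, (1 : Module.End ℂ Fock) = onW S :=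
  ⟨1, (LinearMap.lTensor_id _ _).symm⟩

lemma isHeisField_heis (lam κ₀ : ℂ) : IsHeisField (heis lam κ₀ 0) where
  exists_onW n := by
    rw [heis_eq]
    exact exists_onW_add (exists_onW_add (yMul₀_eq_onW _ _) (exists_onW_smul _ (yDer₀_eq_onW _ _)))
      (exists_onW_smul _ one_eq_onW)
  bddAbove v := by
    have hfin : {n : ℤ | yDer₀ 0 (-n) v ≠ 0}.Finite :=
      (yDer₀_finite 0 v).preimage fun m _ n _ h => neg_injective h
    refine (hfin.bddAbove.union (bddAbove_Iic (a := (0 : ℤ)))).mono fun n hn => ?_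
    by_contra hc
    simp only [Set.mem_union, Set.mem_ofPred_eq, not_or, not_not, Set.mem_Iic] at hc
    refine hn ?_
    rw [heis_eq, yMul₀_of_nonneg (by omega), if_neg (by omega)]
    simp [hc.1]

lemma isHeisField_heis1 (mu nu kap κ₀ : ℂ) : IsHeisField (heis1 mu nu kap κ₀ 0) where
  exists_onW n := by
    rw [heis1_eq]
    exact exists_onW_add (exists_onW_add (exists_onW_add (yMul₀_eq_onW _ _)
      (exists_onW_smul _ (yDer₀_eq_onW _ _))) (exists_onW_smul _ (yDer₀_eq_onW _ _)))
      (exists_onW_smul _ ⟨_, rfl⟩)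
  bddAbove v := by
    have h1 : {n : ℤ | yDer₀ 1 (-n - 1) v ≠ 0}.Finite :=
      (yDer₀_finite 1 v).preimage fun m _ n _ h => by simpa using h
    have h2 : {n : ℤ | yDer₀ 1 (-n - 2) v ≠ 0}.Finite :=
      (yDer₀_finite 1 v).preimage fun m _ n _ h => by simpa using h
    refine ((h1.bddAbove.union h2.bddAbove).union (bddAbove_Iic (a := (0 : ℤ)))).mono
      fun n hn => ?_
    by_contra hc
    simp only [Set.mem_union, Set.mem_ofPred_eq, not_or, not_not, Set.mem_Iic] at hc
    refine hn ?_
    rw [heis1_eq, yMul₀_of_nonneg (by omega), if_neg (by omega)]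
    simp [hc.1]

/-! ### Vacuum expectations -/

/-- The vacuum expectation of an operator: the induced operator on `ℂ[y] ⊗ V`. -/
def vacExp : Module.End ℂ Fock →ₗ[ℂ] Module.End ℂ HeisSpace where
  toFun T := vacProj ∘ₗ T ∘ₗ TensorProduct.mk ℂ PolyX HeisSpace 1
  map_add' S T := by rw [LinearMap.add_comp, LinearMap.comp_add]
  map_smul' c T := by rw [LinearMap.smul_comp, LinearMap.comp_smul, RingHom.id_apply]

lemma vacExp_apply (T : Module.End ℂ Fock) (w : HeisSpace) :
    vacExp T w = vacProj (T (1 ⊗ₜ w)) := rfl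

lemma vacExp_one : vacExp 1 = 1 := by
  refine LinearMap.ext fun w => ?_
  rw [vacExp_apply, Module.End.one_apply, Module.End.one_apply, vacProj_tmul]
  simp

lemma vacProj_onW (S : Module.End ℂ HeisSpace) (v : Fock) : vacProj (onW S v) = S (vacProj v) := by
  induction v using TensorProduct.induction_on with
  | zero => simp
  | add v w hv hw => rw [map_add, map_add, map_add, map_add, hv, hw]
  | tmul p w => rw [onW_tmul, vacProj_tmul, vacProj_tmul, map_smul]

lemma vacProj_xMul (i : Fin 2) (n : ℤ) (v : Fock) : vacProj (xMul i n v) = 0 := by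
  induction v using TensorProduct.induction_on with
  | zero => simp
  | add v w hv hw => rw [map_add, map_add, hv, hw, add_zero]
  | tmul p w =>
    rw [xMul_tmul, vacProj_tmul, MvPolynomial.coeff_X_mul', if_neg (by simp), zero_smul]

lemma vacProj_oscA {r : Fin 2} (i : Fin 2) {n : ℤ} (h : ¬ (0 ≤ n ∧ r = 0)) (v : Fock) :
    vacProj (oscA r i n v) = 0 := by
  rw [oscA, if_neg h, vacProj_xMul]

lemma oscA_vacuum {r : Fin 2} (i : Fin 2) {n : ℤ} (h : 0 ≤ n ∧ r = 0) (w : HeisSpace) :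
    oscA r i n (1 ⊗ₜ w) = 0 := by
  rw [oscA, if_pos h, xDer_tmul, MvPolynomial.pderiv_one, TensorProduct.zero_tmul]

lemma normTerm_vacuum (r i j : Fin 2) (p m : ℤ) (w : HeisSpace) :
    normTerm (alphaSplit r i) (alphaStar r j) p m (1 ⊗ₜ w) =
      if 0 ≤ m ∧ r = 0 then 0 else oscA r i m (alphaStar r j (p - 1 - m) (1 ⊗ₜ w)) := by
  rw [normTerm, alphaSplit_plus, alphaSplit_minus]
  split_ifs with h
  · rw [zero_mul, zero_add, Module.End.mul_apply, oscA_vacuum i h, map_zero]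
  · rw [mul_zero, add_zero, Module.End.mul_apply]

/-- By normal ordering, each summand either kills the vacuum or ends with multiplication by a
variable. -/
lemma vacProj_quad (r i j : Fin 2) (p : ℤ) (w : HeisSpace) :
    vacProj (quad r i j p (1 ⊗ₜ w)) = 0 := by
  rw [quad, normProd, map_locSum (quad_defined r i j p)]
  refine finsum_eq_zero_of_forall_eq_zero fun m => ?_
  rw [normTerm_vacuum]
  split_ifs with h
  · exact map_zero _
  · exact vacProj_oscA i h _

lemma vacProj_oscA_alphaStar (r i l : Fin 2) (m n : ℤ) (w : HeisSpace) :
    vacProj (oscA r i m (alphaStar r l n (1 ⊗ₜ w))) =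
      (if (0 ≤ m ∧ r = 0) ∧ n = -m - 1 ∧ l = i then 1 else 0 : ℂ) • w := by
  by_cases h : 0 ≤ m ∧ r = 0
  · have := LinearMap.congr_fun (adR_oscA_alphaStar r l i n m) (1 ⊗ₜ w)
    rw [adR_apply, LinearMap.sub_apply, Module.End.mul_apply, Module.End.mul_apply,
      oscA_vacuum i h, map_zero, zero_sub, neg_eq_iff_eq_neg] at this
    rw [this, map_neg]
    by_cases h1 : n = -m - 1
    · by_cases h2 : l = i
      · rw [if_pos h1, if_pos h2, if_pos ⟨h, h1, h2⟩, neg_smul, one_smul, LinearMap.neg_apply,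
          map_neg, neg_neg, ← vacExp_apply, vacExp_one, one_smul, Module.End.one_apply]
      · simp [h2]
    · simp [h1]
  · rw [vacProj_oscA i h, if_neg (fun h' => h h'.1), zero_smul]

/-- Only double contractions survive. Moving the left product past the creation mode m of α
contracts once and leaves the mode p + m, which must be an annihilation operator in order to
contract with the remaining starred mode. This needs r = 0 and -p ≤ m < 0, and each such m
contributes -1. -/
lemma vacProj_quad_quad (r i j k l : Fin 2) (p q : ℤ) (w : HeisSpace) :
    vacProj (quad r i j p (quad r k l q (1 ⊗ₜ w))) =
      (if j = k ∧ i = l ∧ p + q = 0 ∧ r = 0 then -(p.toNat : ℂ) else 0) • w := by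
  have hterm : ∀ m, vacProj (quad r i j p (normTerm (alphaSplit r k) (alphaStar r l) q m
      (1 ⊗ₜ w))) = if (m < 0 ∧ 0 ≤ p + m) ∧ (j = k ∧ i = l ∧ p + q = 0 ∧ r = 0) then -w else 0 := by
    intro m
    rw [normTerm_vacuum]
    by_cases h : 0 ≤ m ∧ r = 0
    · rw [if_pos h, map_zero, map_zero, if_neg (by omega)]
    · have := LinearMap.congr_fun (adR_oscA_quad r i j k p m)
        (alphaStar r l (q - 1 - m) (1 ⊗ₜ w))
      rw [adR_apply, LinearMap.sub_apply, Module.End.mul_apply, Module.End.mul_apply,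
        sub_eq_iff_eq_add] at this
      rw [if_neg h, this, map_add, vacProj_oscA k h, add_zero, LinearMap.smul_apply, map_smul,
        vacProj_oscA_alphaStar, smul_smul]
      by_cases hj : j = k
      · by_cases hi : i = l
        · by_cases hpq : p + q = 0
          · by_cases hr : r = 0
            · by_cases hm : 0 ≤ p + m
              · rw [if_pos hj, if_pos ⟨⟨hm, hr⟩, by omega, hi.symm⟩,
                  if_pos ⟨⟨by omega, hm⟩, hj, hi, hpq, hr⟩]
                simp
              · simp [hm]
            · simp [hr]
          · rw [if_neg (c := (0 ≤ p + m ∧ r = 0) ∧ _) (by omega)]; simp [hpq]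
        · simp [hi, Ne.symm hi]
      · simp [hj]
  have hmap := map_locSum (quad_defined r k l q) (vacProj ∘ₗ quad r i j p) (1 ⊗ₜ w)
  simp only [LinearMap.comp_apply] at hmap
  rw [show quad r k l q = locSum (normTerm (alphaSplit r k) (alphaStar r l) q) from rfl, hmap,
    finsum_congr hterm]
  by_cases hc : j = k ∧ i = l ∧ p + q = 0 ∧ r = 0
  · simp only [hc, and_true]
    rw [finsum_eq_sum_of_support_subset (s := Finset.Ico (-p) 0)]
    · rw [Finset.sum_congr rfl (g := fun _ => -w), Finset.sum_const, Int.card_Ico]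
      · have e : (0 - -p).toNat • -w = -(p.toNat : ℂ) • w := by
          rw [zero_sub, neg_neg, ← Nat.cast_smul_eq_nsmul ℂ]; module
        rw [e, if_pos trivial]
      · intro m hm
        rw [Finset.mem_Ico] at hm
        rw [if_pos (by omega)]
    · intro m hm
      rw [Finset.coe_Ico, Set.mem_Ico]
      by_contra hcon
      exact hm (if_neg (by omega))
  · rw [if_neg hc, zero_smul]
    exact finsum_eq_zero_of_forall_eq_zero fun m => if_neg fun h => hc h.2

lemma vacExp_adR_quad_quad (r i j k l : Fin 2) (p q : ℤ) :
    vacExp (adR (quad r k l q) (quad r i j p)) =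
      (if j = k ∧ i = l ∧ p + q = 0 ∧ r = 0 then (q : ℂ) else 0) • 1 := by
  refine LinearMap.ext fun w => ?_
  rw [vacExp_apply, adR_apply, LinearMap.sub_apply, map_sub, Module.End.mul_apply,
    Module.End.mul_apply, vacProj_quad_quad, vacProj_quad_quad, LinearMap.smul_apply,
    Module.End.one_apply]
  refine (sub_smul _ _ w).symm.trans ?_
  congr 1
  by_cases hc : j = k ∧ i = l ∧ p + q = 0 ∧ r = 0
  · obtain ⟨rfl, rfl, hpq, rfl⟩ := hc
    rw [if_pos ⟨rfl, rfl, hpq, rfl⟩, if_pos ⟨rfl, rfl, by omega, rfl⟩, if_pos ⟨rfl, rfl, hpq, rfl⟩]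
    -- Since p = -q, at most one of the two truncated integers is nonzero.
    have : -(p.toNat : ℤ) - -(q.toNat : ℤ) = q := by omega
    exact_mod_cast this
  · rw [if_neg hc, if_neg, sub_zero, if_neg hc]
    rintro ⟨h1, h2, h3, h4⟩
    exact hc ⟨h2.symm, h1.symm, by omega, h4⟩

lemma IsHeisField.vacExp_adR_quad {β : Dist Fock} (hβ : IsHeisField β) (r i j : Fin 2) (p n : ℤ) :
    vacExp (adR (β n) (quad r i j p)) = 0 := by
  obtain ⟨S, hS⟩ := hβ.exists_onW n
  refine LinearMap.ext fun w => ?_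
  rw [vacExp_apply, adR_apply, LinearMap.sub_apply, map_sub, Module.End.mul_apply,
    Module.End.mul_apply, hS, onW_tmul, vacProj_onW, vacProj_quad, vacProj_quad, map_zero, sub_zero,
    LinearMap.zero_apply]

lemma IsHeisField.vacExp_quad_adR {β : Dist Fock} (hβ : IsHeisField β) (r i j : Fin 2) (p n : ℤ) :
    vacExp (adR (quad r i j p) (β n)) = 0 := by
  rw [adR_swap, map_neg, hβ.vacExp_adR_quad]
  exact neg_zero (G := Module.End ℂ HeisSpace)

/-! ### The coefficients of the fields -/

lemma pMul_apply {M : Type} [AddCommGroup M] [Module ℂ M] (a : Dist M) (k : ℤ) :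
    pMul a k = a (k + 2) + (4 : ℂ) • a (k + 1) := by
  change a (k + 1 + 1) + (4 : ℂ) • a (k + 1) = _
  rw [add_assoc]; norm_num

lemma tauH_apply (r : Fin 2) (β : Dist Fock) (p : ℤ) :
    tauH r β p = (2 : ℂ) • (quad r 0 0 p + quad r 1 1 p) + β p := rfl

lemma tauH1_apply (r : Fin 2) (β₁ : Dist Fock) (p : ℤ) : tauH1 r β₁ p =
    (2 : ℂ) • (quad r 1 0 p + (quad r 0 1 (p + 2) + (4 : ℂ) • quad r 0 1 (p + 1))) + β₁ p := by
  rw [← pMul_apply]; rfl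

lemma tauE_apply (r : Fin 2) (χ₀ : ℂ) (β β₁ : Dist Fock) (p : ℤ) : tauE r χ₀ β β₁ p =
    cubic r 0 0 0 p + (cubic r 0 1 1 (p + 2) + (4 : ℂ) • cubic r 0 1 1 (p + 1)) +
      (2 : ℂ) • cubic r 1 0 1 p + plainProd β (alphaStar r 0) p +
      plainProd β₁ (alphaStar r 1) p + (χ₀ * -p) • alphaStar r 0 (p - 1) := by
  rw [← pMul_apply, mul_smul]; rfl

lemma tauE1_apply (r : Fin 2) (χ₀ : ℂ) (β β₁ : Dist Fock) (p : ℤ) : tauE1 r χ₀ β β₁ p =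
    cubic r 1 0 0 p + (cubic r 1 1 1 (p + 2) + (2 : ℂ) • cubic r 0 0 1 (p + 2) +
      (4 : ℂ) • (cubic r 1 1 1 (p + 1) + (2 : ℂ) • cubic r 0 0 1 (p + 1))) +
      plainProd β₁ (alphaStar r 0) p + (plainProd β (alphaStar r 1) (p + 2) +
      (4 : ℂ) • plainProd β (alphaStar r 1) (p + 1)) +
      (χ₀ * -(p + 1)) • alphaStar r 1 (p + 1) + (χ₀ * -(4 * p + 2)) • alphaStar r 1 p := by
  -- The derivative contributes -(p + 2) and -4(p + 1); adding 1 and 2 from (z + 2)α¹* yields -(p +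
  -- 1) and -(4p + 2).
  have h1 : pMul (dz (alphaStar r 1)) p =
      (-(p + 2) : ℂ) • alphaStar r 1 (p + 1) + (4 : ℂ) • (-(p + 1) : ℂ) • alphaStar r 1 p := by
    rw [pMul_apply, dz, dz, show p + 2 - 1 = p + 1 by ring, show p + 1 - 1 = p by ring]
    push_cast; rfl
  change cubic r 1 0 0 p + pMul (cubic r 1 1 1 + (2 : ℂ) • cubic r 0 0 1) p +
      plainProd β₁ (alphaStar r 0) p + pMul (plainProd β (alphaStar r 1)) p +
      χ₀ • (pMul (dz (alphaStar r 1)) p +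
        (alphaStar r 1 (p + 1) + (2 : ℂ) • alphaStar r 1 p)) = _
  rw [h1, pMul_apply, pMul_apply, Pi.add_apply, Pi.add_apply, Pi.smul_apply, Pi.smul_apply]
  module

section Fields

variable {r : Fin 2} {χ₀ : ℂ} {β β₁ : Dist Fock}

lemma adR_oscA_tauH (hβ : IsHeisField β) (l : Fin 2) (p n : ℤ) :
    adR (oscA r l n) (tauH r β p) = (-2 : ℂ) • oscA r l (p + n) := by
  simp only [tauH_apply, map_add, map_smul, adR_oscA_quad, hβ.adR_oscA]
  fin_cases l <;> simp

lemma adR_oscA_zero_tauH1 (hβ₁ : IsHeisField β₁) (p n : ℤ) :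
    adR (oscA r 0 n) (tauH1 r β₁ p) = (-2 : ℂ) • oscA r 1 (p + n) := by
  simp only [tauH1_apply, map_add, map_smul, adR_oscA_quad, hβ₁.adR_oscA]
  simp

lemma adR_oscA_one_tauH1 (hβ₁ : IsHeisField β₁) (p n : ℤ) :
    adR (oscA r 1 n) (tauH1 r β₁ p) =
      (-2 : ℂ) • (oscA r 0 (p + n + 2) + (4 : ℂ) • oscA r 0 (p + n + 1)) := by
  simp only [tauH1_apply, map_add, map_smul, adR_oscA_quad, hβ₁.adR_oscA,
    add_right_comm p _ n, zero_ne_one, if_true, if_false]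
  module

/-- Removing one α* from the cubic and Heisenberg terms reassembles the field of h with a minus
sign; the scalar comes from χ₀ ∂α*. -/
lemma adR_oscA_zero_tauE (hβ : IsHeisField β) (hβ₁ : IsHeisField β₁) (p n : ℤ) :
    adR (oscA r 0 n) (tauE r χ₀ β β₁ p) =
      -tauH r β (p + n) - (if p + n = 0 then χ₀ * n else 0) • 1 := by
  simp only [tauE_apply, tauH_apply, map_add, map_smul, adR_oscA_cubic, hβ.adR_oscA_plainProd,
    hβ₁.adR_oscA_plainProd, adR_oscA_alphaStar, one_ne_zero, if_true, if_false]
  by_cases h : p + n = 0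
  · obtain rfl : p = -n := by omega
    rw [if_pos rfl, if_pos h]
    push_cast
    module
  · rw [if_neg (by omega), if_neg h]
    module

lemma adR_oscA_one_tauE (hβ : IsHeisField β) (hβ₁ : IsHeisField β₁) (p n : ℤ) :
    adR (oscA r 1 n) (tauE r χ₀ β β₁ p) = -tauH1 r β₁ (p + n) := by
  simp only [tauE_apply, tauH1_apply, map_add, map_smul, adR_oscA_cubic, hβ.adR_oscA_plainProd,
    hβ₁.adR_oscA_plainProd, adR_oscA_alphaStar, zero_ne_one, if_true, if_false, zero_smul,
    ite_self, add_right_comm p _ n]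
  module

lemma adR_oscA_zero_tauE1 (hβ : IsHeisField β) (hβ₁ : IsHeisField β₁) (p n : ℤ) :
    adR (oscA r 0 n) (tauE1 r χ₀ β β₁ p) = -tauH1 r β₁ (p + n) := by
  simp only [tauE1_apply, tauH1_apply, map_add, map_smul, adR_oscA_cubic, hβ.adR_oscA_plainProd,
    hβ₁.adR_oscA_plainProd, adR_oscA_alphaStar, one_ne_zero, if_true, if_false, zero_smul,
    ite_self, add_right_comm p _ n]
  module

lemma adR_oscA_one_tauE1 (hβ : IsHeisField β) (hβ₁ : IsHeisField β₁) (p n : ℤ) :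
    adR (oscA r 1 n) (tauE1 r χ₀ β β₁ p) =
      -(tauH r β (p + n + 2) + (4 : ℂ) • tauH r β (p + n + 1)) -
        ((if p + n = -2 then χ₀ * (n + 1) else 0) +
          (if p + n = -1 then χ₀ * (4 * n + 2) else 0)) • 1 := by
  simp only [tauE1_apply, tauH_apply, map_add, map_smul, adR_oscA_cubic, hβ.adR_oscA_plainProd,
    hβ₁.adR_oscA_plainProd, adR_oscA_alphaStar, zero_ne_one, if_true, if_false,
    add_right_comm p _ n]
  by_cases h2 : p + n = -2
  · obtain rfl : p = -n - 2 := by omega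
    rw [if_pos (by ring), if_neg (by omega), if_pos h2, if_neg (by omega)]
    push_cast
    module
  · rw [if_neg (c := p + 1 = _) (by omega), if_neg h2]
    by_cases h1 : p + n = -1
    · obtain rfl : p = -n - 1 := by omega
      rw [if_pos rfl, if_pos h1]
      push_cast
      module
    · rw [if_neg (by omega), if_neg h1]
      module

lemma adR_chargeOp_tauH (hβ : IsHeisField β) (p : ℤ) : adR (chargeOp r) (tauH r β p) = 0 := by
  simp only [tauH_apply, map_add, map_smul, adR_chargeOp_quad]
  rw [chargeOp, hβ.adR_onX]
  simp

lemma adR_chargeOp_tauH1 (hβ₁ : IsHeisField β₁) (p : ℤ) :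
    adR (chargeOp r) (tauH1 r β₁ p) = 0 := by
  simp only [tauH1_apply, map_add, map_smul, adR_chargeOp_quad]
  rw [chargeOp, hβ₁.adR_onX]
  simp

lemma adR_chargeOp_tauE (hβ : IsHeisField β) (hβ₁ : IsHeisField β₁) (p : ℤ) :
    adR (chargeOp r) (tauE r χ₀ β β₁ p) = (-1 : ℂ) • tauE r χ₀ β β₁ p := by
  simp only [tauE_apply, map_add, map_smul, adR_chargeOp_cubic, hβ.adR_chargeOp_plainProd,
    hβ₁.adR_chargeOp_plainProd, adR_chargeOp_alphaStar]
  module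

lemma adR_chargeOp_tauE1 (hβ : IsHeisField β) (hβ₁ : IsHeisField β₁) (p : ℤ) :
    adR (chargeOp r) (tauE1 r χ₀ β β₁ p) = (-1 : ℂ) • tauE1 r χ₀ β β₁ p := by
  simp only [tauE1_apply, map_add, map_smul, adR_chargeOp_cubic, hβ.adR_chargeOp_plainProd,
    hβ₁.adR_chargeOp_plainProd, adR_chargeOp_alphaStar]
  module

end Fields

/-! ### The fields as linear maps on the coordinate ring -/

/-- The commutator as a bilinear map. -/
def brk : Module.End ℂ Fock →ₗ[ℂ] Module.End ℂ Fock →ₗ[ℂ] Module.End ℂ Fock :=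
  LinearMap.mul ℂ _ - (LinearMap.mul ℂ _).flip

lemma brk_apply (S T : Module.End ℂ Fock) : brk S T = adR T S := rfl

/-- The operators `τ(f ⊗ a)`. -/
def opF (r : Fin 2) : Ring3 →ₗ[ℂ] Module.End ℂ Fock := ringLift (tauF r 0) (tauF r 1)

/-- The operators `τ(h ⊗ a)`. -/
def opH (r : Fin 2) (β β₁ : Dist Fock) : Ring3 →ₗ[ℂ] Module.End ℂ Fock :=
  ringLift (tauH r β) (tauH1 r β₁)

/-- The operators `τ(e ⊗ a)`. -/
def opE (r : Fin 2) (χ₀ : ℂ) (β β₁ : Dist Fock) : Ring3 →ₗ[ℂ] Module.End ℂ Fock :=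
  ringLift (tauE r χ₀ β β₁) (tauE1 r χ₀ β β₁)

lemma opF_tPow (r : Fin 2) (n : ℤ) : opF r (tPow n) = -oscA r 0 n := ringLift_tPow _ _ n

lemma opF_uElt_mul (r : Fin 2) (n : ℤ) : opF r (uElt * tPow n) = -oscA r 1 n :=
  ringLift_uElt_mul _ _ n

/-- The commutation relations of the Heisenberg fields, with central charge `κ₀`. -/
structure IsHeisPair (κ₀ : ℂ) (β β₁ : Dist Fock) : Prop where
  left : IsHeisField β
  right : IsHeisField β₁
  comm_left : ∀ m n, adR (β n) (β m) = (if m + n = 0 then 2 * n * κ₀ else 0 : ℂ) • 1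
  comm_mixed : ∀ m n, adR (β₁ n) (β m) = 0
  comm_right : ∀ m n, adR (β₁ n) (β₁ m) = ((if m + n = -2 then 2 * (n + 1) * κ₀ else 0 : ℂ) +
    (if m + n = -1 then 4 * (2 * n + 1) * κ₀ else 0)) • 1

section Relations

variable {r : Fin 2} {κ₀ χ₀ : ℂ} {β β₁ : Dist Fock}

lemma opF_opF (a b : Ring3) : adR (opF r b) (opF r a) = 0 := by
  refine ring_bilin_eq_zero (brk.compl₁₂ (opF r) (opF r)) ?_ ?_ ?_ ?_ a b
  all_goals
    intro m n
    simp only [LinearMap.compl₁₂_apply, brk_apply, opF_tPow, opF_uElt_mul, adR_neg_left]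
    rw [map_neg, adR_oscA_oscA, neg_zero, neg_zero]

lemma opF_opH (h : IsHeisPair κ₀ β β₁) (a b : Ring3) :
    adR (opF r b) (opH r β β₁ a) = (-2 : ℂ) • opF r (a * b) := by
  have := ring_bilin_eq_zero (brk.compl₁₂ (opH r β β₁) (opF r) +
    (2 : ℂ) • (LinearMap.mul ℂ Ring3).compr₂ (opF r)) ?_ ?_ ?_ ?_ a b
  · rw [LinearMap.add_apply, LinearMap.add_apply, add_eq_zero_iff_eq_neg] at this
    rw [neg_smul]
    exact this
  all_goals
    intro m n
    simp only [LinearMap.compl₁₂_apply, LinearMap.add_apply, LinearMap.smul_apply,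
      LinearMap.compr₂_apply, LinearMap.mul_apply', brk_apply, tPow_mul, tPow_mul_uElt,
      uElt_mul_tPow, uElt_mul_uElt, map_add, map_smul, opF_tPow, opF_uElt_mul, adR_neg_left, opH,
      ringLift_tPow, ringLift_uElt_mul, adR_oscA_tauH h.left, adR_oscA_zero_tauH1 h.right,
      adR_oscA_one_tauH1 h.right]
    module

/-- This relation holds for every χ₀; the link between χ₀ and κ₀ enters only through [H,H]. -/
lemma opF_opE (h : IsHeisPair κ₀ β β₁) (a b : Ring3) :
    adR (opF r b) (opE r χ₀ β β₁ a) = opH r β β₁ (a * b) + (χ₀ * resForm a b) • 1 := by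
  have := ring_bilin_eq_zero (brk.compl₁₂ (opE r χ₀ β β₁) (opF r) -
    (LinearMap.mul ℂ Ring3).compr₂ (opH r β β₁) -
      resForm.compr₂ (χ₀ • LinearMap.toSpanSingleton ℂ (Module.End ℂ Fock) 1)) ?_ ?_ ?_ ?_ a b
  · rw [LinearMap.sub_apply, LinearMap.sub_apply, LinearMap.sub_apply, LinearMap.sub_apply,
      sub_sub, sub_eq_zero] at this
    refine this.trans ?_
    rw [mul_smul]
    rfl
  all_goals
    intro m n
    simp only [LinearMap.compl₁₂_apply, LinearMap.sub_apply, LinearMap.smul_apply,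
      LinearMap.compr₂_apply, LinearMap.mul_apply', LinearMap.toSpanSingleton_apply, brk_apply,
      tPow_mul, tPow_mul_uElt, uElt_mul_tPow, uElt_mul_uElt, map_add, map_smul, opF_tPow,
      opF_uElt_mul, adR_neg_left, opH, opE, ringLift_tPow, ringLift_uElt_mul,
      adR_oscA_zero_tauE h.left h.right, adR_oscA_one_tauE h.left h.right,
      adR_oscA_zero_tauE1 h.left h.right, adR_oscA_one_tauE1 h.left h.right, resForm_tt,
      resForm_tu, resForm_ut, resForm_uu]
    try split_ifs
    all_goals module

lemma chargeOp_opH (h : IsHeisPair κ₀ β β₁) (a : Ring3) :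
    adR (chargeOp r) (opH r β β₁ a) = 0 := by
  induction a using ring_induction with
  | ht n => rw [opH, ringLift_tPow, adR_chargeOp_tauH h.left]
  | hu n => rw [opH, ringLift_uElt_mul, adR_chargeOp_tauH1 h.right]
  | hadd a b ha hb => rw [(opH r β β₁).map_add, map_add, ha, hb, add_zero]
  | hsmul c a ha => rw [map_smul, map_smul, ha, smul_zero]

lemma chargeOp_opE (h : IsHeisPair κ₀ β β₁) (a : Ring3) :
    adR (chargeOp r) (opE r χ₀ β β₁ a) = (-1 : ℂ) • opE r χ₀ β β₁ a := by
  induction a using ring_induction with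
  | ht n => rw [opE, ringLift_tPow, adR_chargeOp_tauE h.left h.right]
  | hu n => rw [opE, ringLift_uElt_mul, adR_chargeOp_tauE1 h.left h.right]
  | hadd a b ha hb => rw [(opE r χ₀ β β₁).map_add, map_add, ha, hb, smul_add]
  | hsmul c a ha => rw [map_smul, map_smul, ha, smul_comm]

/-- `eq_zero_of_commute_oscA` in terms of `opF`. -/
lemma eq_zero_of_commute_opF {T : Module.End ℂ Fock} (hT : ∀ c, adR (opF r c) T = 0) {d : ℕ}
    (hd : adR (chargeOp r) T = (-d : ℂ) • T) (h0 : d = 0 → vacExp T = 0) : T = 0 := by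
  refine eq_zero_of_commute_oscA (r := r) (d := d) (fun i n => ?_) hd
    fun h w => LinearMap.congr_fun (h0 h) w
  rw [← neg_eq_zero, ← adR_neg_left]
  fin_cases i
  · exact opF_tPow r n ▸ hT (tPow n)
  · exact opF_uElt_mul r n ▸ hT (uElt * tPow n)

/-- For r = 0 each of the two quadratic terms contracts with itself and contributes 2 · 2 · n. Their
sum 8n is the shift by 4 in 2nχ₀. -/
lemma vacExp_tauH_tauH (h : IsHeisPair κ₀ β β₁) (hχ₀ : χ₀ = κ₀ + 4 * (if r = 0 then 1 else 0))
    (m n : ℤ) : vacExp (adR (tauH r β n) (tauH r β m)) =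
      (if m + n = 0 then 2 * n * χ₀ else 0 : ℂ) • 1 := by
  simp only [tauH_apply, map_add, map_smul, adR_add_left, adR_smul_left, vacExp_adR_quad_quad,
    h.left.vacExp_adR_quad, h.left.vacExp_quad_adR, h.comm_left, vacExp_one, zero_ne_one,
    one_ne_zero, false_and, if_false, true_and]
  by_cases hmn : m + n = 0
  · by_cases hr : r = 0
    · simp only [hmn, hr, and_self, if_true, hχ₀]; module
    · simp only [hmn, hr, and_false, if_true, if_false, hχ₀]; module
  · simp only [hmn, false_and, if_false]; module

/-- A double contraction pairs the indices (i, j) with (j, i), but one field has diagonal quadratic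
terms and the other off-diagonal ones. -/
lemma vacExp_tauH1_tauH (h : IsHeisPair κ₀ β β₁) (m n : ℤ) :
    vacExp (adR (tauH1 r β₁ n) (tauH r β m)) = 0 := by
  simp only [tauH_apply, tauH1_apply, map_add, map_smul, adR_add_left, adR_smul_left,
    vacExp_adR_quad_quad, h.right.vacExp_adR_quad, h.left.vacExp_quad_adR, h.comm_mixed,
    zero_ne_one, one_ne_zero, false_and, and_false, if_false, true_and]
  simp

lemma vacExp_tauH1_tauH1 (h : IsHeisPair κ₀ β β₁)
    (hχ₀ : χ₀ = κ₀ + 4 * (if r = 0 then 1 else 0)) (m n : ℤ) :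
    vacExp (adR (tauH1 r β₁ n) (tauH1 r β₁ m)) =
      ((if m + n = -2 then 2 * (n + 1) * χ₀ else 0 : ℂ) +
        (if m + n = -1 then 4 * (2 * n + 1) * χ₀ else 0)) • 1 := by
  simp only [tauH1_apply, map_add, map_smul, adR_add_left, adR_smul_left,
    vacExp_adR_quad_quad, h.right.vacExp_adR_quad, h.right.vacExp_quad_adR, h.comm_right,
    vacExp_one, zero_ne_one, one_ne_zero, false_and, if_false, true_and]
  simp only [hχ₀, show m + (n + 2) = 0 ↔ m + n = -2 by omega,
    show m + (n + 1) = 0 ↔ m + n = -1 by omega, show m + 2 + n = 0 ↔ m + n = -2 by omega,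
    show m + 1 + n = 0 ↔ m + n = -1 by omega]
  by_cases hr : r = 0
  · simp only [hr, and_true, if_true]
    split_ifs <;> (push_cast; module)
  · simp only [hr, and_false, if_false, mul_zero, add_zero]
    module

/-- Bracketing [H,H] with F gives, by Jacobi, two multiples of F(abc) that cancel. Since the charge
is 0, what remains is the vacuum expectation on basis elements of R. -/
lemma opH_opH (h : IsHeisPair κ₀ β β₁) (hχ₀ : χ₀ = κ₀ + 4 * (if r = 0 then 1 else 0))
    (a b : Ring3) : adR (opH r β β₁ b) (opH r β β₁ a) = (2 * χ₀ * resForm a b) • 1 := by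
  rw [← sub_eq_zero]
  refine eq_zero_of_commute_opF (r := r) (d := 0) (fun c => ?_) ?_ fun _ => ?_
  · rw [map_sub, map_smul, adR_one, smul_zero, sub_zero, adR_jacobi, opF_opH h, opF_opH h,
      adR_smul_left, map_smul, opF_opH h, adR_swap, opF_opH h, mul_left_comm b a c]
    module
  · rw [map_sub, map_smul, adR_one, smul_zero, sub_zero, adR_jacobi, chargeOp_opH h,
      chargeOp_opH h, adR_zero_left, map_zero]
    simp
  · have := ring_bilin_eq_zero ((brk.compl₁₂ (opH r β β₁) (opH r β β₁)).compr₂ vacExp +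
      resForm.compr₂ ((-(2 * χ₀)) • LinearMap.toSpanSingleton ℂ (Module.End ℂ HeisSpace) 1))
      ?_ ?_ ?_ ?_ a b
    · rw [sub_eq_add_neg, ← neg_smul, map_add, map_smul, vacExp_one, ← neg_mul, mul_smul]
      exact this
    all_goals
      intro m n
      simp only [LinearMap.compl₁₂_apply, LinearMap.add_apply, LinearMap.smul_apply,
        LinearMap.compr₂_apply, LinearMap.toSpanSingleton_apply, brk_apply, opH, ringLift_tPow,
        ringLift_uElt_mul, resForm_tt, resForm_tu, resForm_ut, resForm_uu,
        vacExp_tauH_tauH h hχ₀, vacExp_tauH1_tauH h, vacExp_tauH1_tauH1 h hχ₀]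
    · split_ifs <;> module
    · module
    · rw [adR_swap, ← neg_one_smul ℂ, map_smul, vacExp_tauH1_tauH h]
      module
    · split_ifs <;> module

/-- Both sides raise the charge by 1, so it suffices to bracket with F. The scalar parts, one from
[H,H] and one from [E,F], agree by `resForm_mul`. -/
lemma opE_opH (h : IsHeisPair κ₀ β β₁) (hχ₀ : χ₀ = κ₀ + 4 * (if r = 0 then 1 else 0))
    (a b : Ring3) :
    adR (opE r χ₀ β β₁ b) (opH r β β₁ a) = (2 : ℂ) • opE r χ₀ β β₁ (a * b) := by
  rw [← sub_eq_zero]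
  refine eq_zero_of_commute_opF (r := r) (d := 1) (fun c => ?_) ?_ fun h0 => absurd h0 one_ne_zero
  · rw [map_sub, map_smul, adR_jacobi, opF_opE h, opF_opE h, opF_opH h, adR_add_left,
      adR_smul_left, adR_one_left, map_smul, adR_swap (opE r χ₀ β β₁ b), opF_opE h,
      opH_opH h hχ₀, resForm_mul, mul_left_comm b a c, mul_assoc a b c]
    module
  · rw [map_sub, map_smul, adR_jacobi, chargeOp_opE h, chargeOp_opE h, chargeOp_opH h,
      adR_smul_left, map_zero]
    push_cast
    module

/-- The charge is raised by 2, and the bracket with F is a sum of two [E,H] terms that cancel. -/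
lemma opE_opE (h : IsHeisPair κ₀ β β₁) (hχ₀ : χ₀ = κ₀ + 4 * (if r = 0 then 1 else 0))
    (a b : Ring3) : adR (opE r χ₀ β β₁ b) (opE r χ₀ β β₁ a) = 0 := by
  refine eq_zero_of_commute_opF (r := r) (d := 2) (fun c => ?_) ?_ fun h0 => absurd h0 two_ne_zero
  · rw [adR_jacobi, opF_opE h, opF_opE h, (adR (opE r χ₀ β β₁ b)).map_add, map_smul, adR_one, adR_add_left, adR_smul_left,
      adR_one_left, adR_swap (opH r β β₁ (b * c)), opE_opH h hχ₀, opE_opH h hχ₀,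
      show b * c * a = a * c * b by ring]
    module
  · rw [adR_jacobi, chargeOp_opE h, chargeOp_opE h, adR_smul_left, map_smul]
    push_cast
    module

end Relations

/-! ### The representation -/

lemma sl2_apply_one_one (x : Sl2) : x.1 1 1 = -x.1 0 0 := by
  have h : Matrix.trace x.1 = 0 := LinearMap.mem_ker.mp x.2
  rw [Matrix.trace_fin_two] at h
  exact eq_neg_of_add_eq_zero_right h

lemma sl2_add_apply (x y : Sl2) (i j : Fin 2) : (x + y).1 i j = x.1 i j + y.1 i j := rfl

lemma sl2_smul_apply (c : ℂ) (x : Sl2) (i j : Fin 2) : (c • x).1 i j = c * x.1 i j := rfl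

lemma form_apply (x y : Sl2) :
    form x y = 2 * (x.1 0 0 * y.1 0 0) + x.1 0 1 * y.1 1 0 + x.1 1 0 * y.1 0 1 := by
  change Matrix.trace (x.1 * y.1) = _
  rw [Matrix.trace_fin_two, Matrix.mul_apply, Matrix.mul_apply, Fin.sum_univ_two, Fin.sum_univ_two,
    sl2_apply_one_one x, sl2_apply_one_one y]
  ring

lemma lie_apply (x y : Sl2) (i j : Fin 2) : (⁅x, y⁆ : Sl2).1 i j =
    x.1 i 0 * y.1 0 j + x.1 i 1 * y.1 1 j - (y.1 i 0 * x.1 0 j + y.1 i 1 * x.1 1 j) := by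
  change (x.1 * y.1 - y.1 * x.1) i j = _
  rw [Matrix.sub_apply, Matrix.mul_apply,
    Matrix.mul_apply, Fin.sum_univ_two, Fin.sum_univ_two]

section

variable (r : Fin 2) (χ₀ : ℂ) (β β₁ : Dist Fock)

/-- The linear map `τ` on `sl(2, ℂ) ⊗ R`. -/
def loopMap : Ring3 ⊗[ℂ] Sl2 →ₗ[ℂ] Module.End ℂ Fock :=
  TensorProduct.lift (LinearMap.mk₂ ℂ
    (fun a x => x.1 0 1 • opE r χ₀ β β₁ a + x.1 1 0 • opF r a + x.1 0 0 • opH r β β₁ a)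
    (fun a a' x => by
      rw [(opE r χ₀ β β₁).map_add, (opF r).map_add, (opH r β β₁).map_add]; module)
    (fun c a x => by rw [map_smul, map_smul, map_smul]; module)
    (fun a x y => by
      rw [sl2_add_apply, sl2_add_apply, sl2_add_apply]; module)
    (fun c a x => by
      rw [sl2_smul_apply, sl2_smul_apply, sl2_smul_apply]; module))

lemma loopMap_tmul (a : Ring3) (x : Sl2) : loopMap r χ₀ β β₁ (a ⊗ₜ x) =
    x.1 0 1 • opE r χ₀ β β₁ a + x.1 1 0 • opF r a + x.1 0 0 • opH r β β₁ a := rfl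

/-- The linear map `τ`. -/
def tauLin : Alg3 →ₗ[ℂ] Module.End ℂ Fock where
  toFun X := loopMap r χ₀ β β₁ X.1 + (χ₀ * residue X.2) • 1
  map_add' X Y := by
    change loopMap r χ₀ β β₁ (X.1 + Y.1) + (χ₀ * residue (X.2 + Y.2)) • 1 = _
    rw [(loopMap r χ₀ β β₁).map_add, residue.map_add]; module
  map_smul' c X := by
    change loopMap r χ₀ β β₁ (c • X.1) + (χ₀ * residue (c • X.2)) • 1 = _
    rw [map_smul, map_smul, RingHom.id_apply, smul_eq_mul]; module

variable {r χ₀ β β₁} {κ₀ : ℂ}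

lemma loopMap_lie_tmul (h : IsHeisPair κ₀ β β₁) (hχ₀ : χ₀ = κ₀ + 4 * (if r = 0 then 1 else 0))
    (a b : Ring3) (x y : Sl2) :
    loopMap r χ₀ β β₁ ⁅a ⊗ₜ[ℂ] x, b ⊗ₜ[ℂ] y⁆ +
        (χ₀ * residue (cocycle Ring3 (a ⊗ₜ x) (b ⊗ₜ y))) • 1 =
      adR (loopMap r χ₀ β β₁ (b ⊗ₜ y)) (loopMap r χ₀ β β₁ (a ⊗ₜ x)) := by
  have hFE : adR (opE r χ₀ β β₁ b) (opF r a) =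
      -opH r β β₁ (a * b) + (χ₀ * resForm a b) • 1 := by
    rw [adR_swap, opF_opE h, mul_comm b a, resForm_swap a b]; module
  have hFH : adR (opH r β β₁ b) (opF r a) = (2 : ℂ) • opF r (a * b) := by
    rw [adR_swap, opF_opH h, mul_comm b a]; module
  have hEH : adR (opH r β β₁ b) (opE r χ₀ β β₁ a) = (-2 : ℂ) • opE r χ₀ β β₁ (a * b) := by
    rw [adR_swap, opE_opH h hχ₀, mul_comm b a]; module
  rw [LieAlgebra.ExtendScalars.bracket_tmul, cocycle_tmul, map_smul, residue_diffClass,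
    ← resForm_apply, loopMap_tmul, loopMap_tmul, loopMap_tmul]
  simp only [adR_add_left, adR_smul_left, map_add, map_smul, hFE, hFH, hEH, opF_opF, opF_opH h,
    opF_opE h, opH_opH h hχ₀, opE_opH h hχ₀, opE_opE h hχ₀, lie_apply, form_apply,
    sl2_apply_one_one x, sl2_apply_one_one y, smul_eq_mul]
  module

lemma loopMap_lie (h : IsHeisPair κ₀ β β₁) (hχ₀ : χ₀ = κ₀ + 4 * (if r = 0 then 1 else 0))
    (s t : Ring3 ⊗[ℂ] Sl2) :
    loopMap r χ₀ β β₁ ⁅s, t⁆ + (χ₀ * residue (cocycle Ring3 s t)) • 1 =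
      adR (loopMap r χ₀ β β₁ t) (loopMap r χ₀ β β₁ s) := by
  have hadd (p q s : Ring3 ⊗[ℂ] Sl2) : ⁅p + q, s⁆ = ⁅p, s⁆ + ⁅q, s⁆ :=
    add_lie (L := Ring3 ⊗[ℂ] Sl2) (M := Ring3 ⊗[ℂ] Sl2) p q s
  have hadd' (p q s : Ring3 ⊗[ℂ] Sl2) : ⁅p, q + s⁆ = ⁅p, q⁆ + ⁅p, s⁆ :=
    lie_add (L := Ring3 ⊗[ℂ] Sl2) (M := Ring3 ⊗[ℂ] Sl2) p q s
  have hz (p : Ring3 ⊗[ℂ] Sl2) : ⁅(0 : Ring3 ⊗[ℂ] Sl2), p⁆ = 0 :=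
    zero_lie (L := Ring3 ⊗[ℂ] Sl2) (M := Ring3 ⊗[ℂ] Sl2) p
  have hz' (p : Ring3 ⊗[ℂ] Sl2) : ⁅p, (0 : Ring3 ⊗[ℂ] Sl2)⁆ = 0 :=
    lie_zero (L := Ring3 ⊗[ℂ] Sl2) (M := Ring3 ⊗[ℂ] Sl2) p
  induction s using TensorProduct.induction_on with
  | zero => simp [hz]
  | add s s' hs hs' =>
    rw [hadd, (loopMap r χ₀ β β₁).map_add, (loopMap r χ₀ β β₁).map_add, (cocycle Ring3).map_add,
      LinearMap.add_apply, residue.map_add, (adR _).map_add, ← hs, ← hs']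
    module
  | tmul a x =>
    induction t using TensorProduct.induction_on with
    | zero => simp [hz', adR_zero_left]
    | add t t' ht ht' =>
      rw [hadd', (loopMap r χ₀ β β₁).map_add, (loopMap r χ₀ β β₁).map_add,
        (cocycle Ring3 _).map_add, residue.map_add, adR_add_left, ← ht, ← ht']
      module
    | tmul b y => exact loopMap_lie_tmul h hχ₀ a b x y

/-- The representation `τ`. -/
def tauHom (h : IsHeisPair κ₀ β β₁) (hχ₀ : χ₀ = κ₀ + 4 * (if r = 0 then 1 else 0)) :
    Alg3 →ₗ⁅ℂ⁆ Module.End ℂ Fock :=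
  { tauLin r χ₀ β β₁ with
    map_lie' := fun {X Y} => by
      change loopMap r χ₀ β β₁ ⁅X.1, Y.1⁆ + (χ₀ * residue (cocycle Ring3 X.1 Y.1)) • 1 =
        adR (loopMap r χ₀ β β₁ Y.1 + (χ₀ * residue Y.2) • 1)
          (loopMap r χ₀ β β₁ X.1 + (χ₀ * residue X.2) • 1)
      rw [loopMap_lie h hχ₀, (adR _).map_add, map_smul, adR_one, adR_add_left, adR_smul_left,
        adR_one_left]
      simp }

lemma tauHom_apply (h : IsHeisPair κ₀ β β₁) (hχ₀ : χ₀ = κ₀ + 4 * (if r = 0 then 1 else 0))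
    (X : Alg3) : tauHom h hχ₀ X = loopMap r χ₀ β β₁ X.1 + (χ₀ * residue X.2) • 1 := rfl

lemma tauHom_tmul (h : IsHeisPair κ₀ β β₁) (hχ₀ : χ₀ = κ₀ + 4 * (if r = 0 then 1 else 0))
    (a : Ring3) (x : Sl2) : tauHom h hχ₀ ((a ⊗ₜ x, 0) : (Ring3 ⊗[ℂ] Sl2) × DiffModExact Ring3) =
      x.1 0 1 • opE r χ₀ β β₁ a + x.1 1 0 • opF r a + x.1 0 0 • opH r β β₁ a := by
  change loopMap r χ₀ β β₁ (a ⊗ₜ x) + (χ₀ * residue 0) • 1 = _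
  rw [map_zero, mul_zero, zero_smul, add_zero, loopMap_tmul]

lemma tauHom_slF (h : IsHeisPair κ₀ β β₁) (hχ₀ : χ₀ = κ₀ + 4 * (if r = 0 then 1 else 0))
    (a : Ring3) :
    tauHom h hχ₀ ((a ⊗ₜ slF, 0) : (Ring3 ⊗[ℂ] Sl2) × DiffModExact Ring3) = opF r a := by
  rw [tauHom_tmul]; simp [slF]

lemma tauHom_slH (h : IsHeisPair κ₀ β β₁) (hχ₀ : χ₀ = κ₀ + 4 * (if r = 0 then 1 else 0))
    (a : Ring3) :
    tauHom h hχ₀ ((a ⊗ₜ slH, 0) : (Ring3 ⊗[ℂ] Sl2) × DiffModExact Ring3) = opH r β β₁ a := by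
  rw [tauHom_tmul]; simp [slH]

lemma tauHom_slE (h : IsHeisPair κ₀ β β₁) (hχ₀ : χ₀ = κ₀ + 4 * (if r = 0 then 1 else 0))
    (a : Ring3) :
    tauHom h hχ₀ ((a ⊗ₜ slE, 0) : (Ring3 ⊗[ℂ] Sl2) × DiffModExact Ring3) = opE r χ₀ β β₁ a := by
  rw [tauHom_tmul]; simp [slE]

end

/-! ### Uniqueness -/

/-- The inclusion of `sl(2, ℂ) ⊗ R` as a linear map. -/
def loopIncl : Ring3 ⊗[ℂ] Sl2 →ₗ[ℂ] Alg3 :=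
  (LinearMap.inl ℂ (Ring3 ⊗[ℂ] Sl2) (DiffModExact Ring3) :
    Ring3 ⊗[ℂ] Sl2 →ₗ[ℂ] (Ring3 ⊗[ℂ] Sl2) × DiffModExact Ring3)

/-- The inclusion of the center `Ω¹_R / dR`, on the level of differentials. -/
def centralIncl : Ω[Ring3⁄ℂ] →ₗ[ℂ] Alg3 :=
  (LinearMap.inr ℂ (Ring3 ⊗[ℂ] Sl2) (DiffModExact Ring3) ∘ₗ diffClass :
    Ω[Ring3⁄ℂ] →ₗ[ℂ] (Ring3 ⊗[ℂ] Sl2) × DiffModExact Ring3)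

lemma sl2_eq (x : Sl2) : x = x.1 0 1 • slE + x.1 1 0 • slF + x.1 0 0 • slH := by
  apply Subtype.ext
  ext i j
  fin_cases i <;> fin_cases j <;> simp [slE, slF, slH, sl2_apply_one_one]

/-- Since (e, f) = 1, the central class of a db is expressed through a bracket and an element of
sl(2) ⊗ R. -/
lemma lie_slE_slF (a b : Ring3) :
    ⁅loopIncl (a ⊗ₜ slE), loopIncl (b ⊗ₜ slF)⁆ =
      loopIncl ((a * b) ⊗ₜ ⁅slE, slF⁆) + centralIncl (a • KaehlerDifferential.D ℂ Ring3 b) := by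
  change ((⁅a ⊗ₜ[ℂ] slE, b ⊗ₜ[ℂ] slF⁆, cocycle Ring3 (a ⊗ₜ slE) (b ⊗ₜ slF)) :
    (Ring3 ⊗[ℂ] Sl2) × DiffModExact Ring3) = ((a * b) ⊗ₜ ⁅slE, slF⁆ + 0, 0 + diffClass _)
  rw [LieAlgebra.ExtendScalars.bracket_tmul, cocycle_tmul, add_zero, zero_add,
    show form slE slF = 1 by rw [form_apply]; simp [slE, slF], one_smul]

/-- A homomorphism from the three point algebra is determined by its values on the modes. -/
lemma algHom_ext {L : Type*} [LieRing L] [LieAlgebra ℂ L] {σ τ : Alg3 →ₗ⁅ℂ⁆ L}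
    (h : ∀ x : Sl2, x = slE ∨ x = slF ∨ x = slH → ∀ n,
      σ (mode x n) = τ (mode x n) ∧ σ (mode1 x n) = τ (mode1 x n)) : σ = τ := by
  have hbasis : ∀ x : Sl2, x = slE ∨ x = slF ∨ x = slH → ∀ a,
      σ (loopIncl (a ⊗ₜ x)) = τ (loopIncl (a ⊗ₜ x)) := by
    intro x hx a
    induction a using ring_induction with
    | ht n => exact (h x hx n).1
    | hu n => exact (h x hx n).2
    | hadd a b ha hb =>
      rw [TensorProduct.add_tmul, loopIncl.map_add, map_add σ, map_add τ, ha, hb]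
    | hsmul c a ha => rw [← TensorProduct.smul_tmul', map_smul, map_smul σ, map_smul τ, ha]
  have hloop : ∀ s, σ (loopIncl s) = τ (loopIncl s) := by
    intro s
    induction s using TensorProduct.induction_on with
    | zero => rw [map_zero, map_zero σ, map_zero τ]
    | add s t hs ht => rw [loopIncl.map_add, map_add σ, map_add τ, hs, ht]
    | tmul a x =>
      rw [sl2_eq x]
      simp only [TensorProduct.tmul_add, TensorProduct.tmul_smul, map_smul, loopIncl.map_add,
        map_add σ, map_add τ, map_smul σ, map_smul τ, hbasis slE (by simp), hbasis slF (by simp),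
        hbasis slH (by simp)]
  have hcentral : ∀ w, σ (centralIncl w) = τ (centralIncl w) := by
    intro w
    have hw : w ∈ Submodule.span Ring3 (Set.range (KaehlerDifferential.D ℂ Ring3)) := by
      rw [KaehlerDifferential.span_range_derivation]; trivial
    -- The exact differentials span only over R, whereas σ and τ are linear over ℂ; quantifying over
    -- all R-multiples of w makes the span induction go through.
    suffices ∀ a : Ring3, σ (centralIncl (a • w)) = τ (centralIncl (a • w)) by
      simpa using this 1
    induction hw using Submodule.span_induction with
    | mem w hw =>
      obtain ⟨b, rfl⟩ := hw
      intro a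
      have e := lie_slE_slF a b
      have h1 := congrArg σ e
      have h2 := congrArg τ e
      rw [LieHom.map_lie, map_add σ, hloop, hloop, hloop] at h1
      rw [LieHom.map_lie, map_add τ] at h2
      exact add_left_cancel (h1.symm.trans h2)
    | zero => intro a; simp
    | add w w' _ _ hw hw' =>
      intro a
      rw [smul_add, centralIncl.map_add, map_add σ, map_add τ, hw, hw']
    | smul b w _ hw => intro a; rw [smul_smul]; exact hw _
  ext X
  obtain ⟨w, hw⟩ := Submodule.mkQ_surjective _ X.2
  have hX : X = loopIncl X.1 + centralIncl w := by
    change X = ((X.1 + 0, 0 + diffClass w) : (Ring3 ⊗[ℂ] Sl2) × DiffModExact Ring3)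
    rw [add_zero, zero_add, diffClass, hw]; rfl
  rw [hX, map_add σ, map_add τ, hloop, hcentral]

end ThreePoint

end

/-! ### The realization theorem -/

theorem mainTheorem1 (r : Fin 2) (lam mu nu kap κ₀ χ₀ χ₁ : ℂ)
    (hχ₀ : χ₀ = κ₀ + 4 * (if r = 0 then 1 else 0)) (hχ₁ : χ₁ = 0)
    (β β₁ : ThreePoint.Dist ThreePoint.Fock)
    (hβ : β = ThreePoint.heis lam κ₀ χ₁) (hβ₁ : β₁ = ThreePoint.heis1 mu nu kap κ₀ χ₁) :
    -- all the products of fields that occur are defined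
    ((∀ i j : Fin 2,
        ThreePoint.NormDefined (ThreePoint.alphaSplit r i) (ThreePoint.alphaStar r j)) ∧
      (∀ j k : Fin 2,
        ThreePoint.NormDefined (ThreePoint.alphaStarSplit r j) (ThreePoint.alphaStar r k)) ∧
      (∀ i j k : Fin 2,
        ThreePoint.NormDefined (ThreePoint.alphaSplit r i) (ThreePoint.starQuad r j k)) ∧
      (∀ j : Fin 2, ThreePoint.PlainDefined β (ThreePoint.alphaStar r j)) ∧
      (∀ j : Fin 2, ThreePoint.PlainDefined β₁ (ThreePoint.alphaStar r j))) ∧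
    -- the formulas define a representation
    ∃! τ : ThreePoint.Alg3 →ₗ⁅ℂ⁆ Module.End ℂ ThreePoint.Fock,
      τ ThreePoint.omega1 = 0 ∧
      τ ThreePoint.omega0 = χ₀ • (1 : Module.End ℂ ThreePoint.Fock) ∧
      (∀ n : ℤ, τ (ThreePoint.mode ThreePoint.slF n) = ThreePoint.tauF r 0 n) ∧
      (∀ n : ℤ, τ (ThreePoint.mode1 ThreePoint.slF n) = ThreePoint.tauF r 1 n) ∧
      (∀ n : ℤ, τ (ThreePoint.mode ThreePoint.slH n) = ThreePoint.tauH r β n) ∧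
      (∀ n : ℤ, τ (ThreePoint.mode1 ThreePoint.slH n) = ThreePoint.tauH1 r β₁ n) ∧
      (∀ n : ℤ, τ (ThreePoint.mode ThreePoint.slE n) = ThreePoint.tauE r χ₀ β β₁ n) ∧
      (∀ n : ℤ, τ (ThreePoint.mode1 ThreePoint.slE n) = ThreePoint.tauE1 r χ₀ β β₁ n) := by
  subst hχ₁ hβ hβ₁
  have h : ThreePoint.IsHeisPair κ₀ (ThreePoint.heis lam κ₀ 0)
      (ThreePoint.heis1 mu nu kap κ₀ 0) :=
    ⟨ThreePoint.isHeisField_heis _ _, ThreePoint.isHeisField_heis1 _ _ _ _,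
      ThreePoint.adR_heis_heis _ _, ThreePoint.adR_heis1_heis _ _ _ _ _,
      ThreePoint.adR_heis1_heis1 _ _ _ _⟩
  refine ⟨⟨ThreePoint.quad_defined r, ThreePoint.normDefined_alphaStarSplit r,
    ThreePoint.cubic_defined r, h.left.plainDefined r, h.right.plainDefined r⟩,
    ThreePoint.tauHom h hχ₀, ⟨?_, ?_, ?_, ?_, ?_, ?_, ?_, ?_⟩, ?_⟩
  · rw [ThreePoint.tauHom_apply, ThreePoint.residue_omega1, ThreePoint.omega1]
    simp
  · rw [ThreePoint.tauHom_apply, ThreePoint.residue_omega0, ThreePoint.omega0]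
    simp
  · exact fun n => (ThreePoint.tauHom_slF h hχ₀ _).trans (ThreePoint.ringLift_tPow _ _ n)
  · exact fun n => (ThreePoint.tauHom_slF h hχ₀ _).trans (ThreePoint.ringLift_uElt_mul _ _ n)
  · exact fun n => (ThreePoint.tauHom_slH h hχ₀ _).trans (ThreePoint.ringLift_tPow _ _ n)
  · exact fun n => (ThreePoint.tauHom_slH h hχ₀ _).trans (ThreePoint.ringLift_uElt_mul _ _ n)
  · exact fun n => (ThreePoint.tauHom_slE h hχ₀ _).trans (ThreePoint.ringLift_tPow _ _ n)
  · exact fun n => (ThreePoint.tauHom_slE h hχ₀ _).trans (ThreePoint.ringLift_uElt_mul _ _ n)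
  · rintro σ ⟨-, -, hf, hf1, hh, hh1, he, he1⟩
    refine ThreePoint.algHom_ext ?_
    rintro x (rfl | rfl | rfl) n
    · exact ⟨(he n).trans ((ThreePoint.tauHom_slE h hχ₀ _).trans
        (ThreePoint.ringLift_tPow _ _ n)).symm, (he1 n).trans
        ((ThreePoint.tauHom_slE h hχ₀ _).trans (ThreePoint.ringLift_uElt_mul _ _ n)).symm⟩
    · exact ⟨(hf n).trans ((ThreePoint.tauHom_slF h hχ₀ _).trans
        (ThreePoint.ringLift_tPow _ _ n)).symm, (hf1 n).trans
        ((ThreePoint.tauHom_slF h hχ₀ _).trans (ThreePoint.ringLift_uElt_mul _ _ n)).symm⟩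
    · exact ⟨(hh n).trans ((ThreePoint.tauHom_slH h hχ₀ _).trans
        (ThreePoint.ringLift_tPow _ _ n)).symm, (hh1 n).trans
        ((ThreePoint.tauHom_slH h hχ₀ _).trans (ThreePoint.ringLift_uElt_mul _ _ n)).symm⟩
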